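/- Let $k\ge 2$ be an integer. A positive integer $n$ is $k$-full if $p^k\mid n$ for every prime $p\mid n$; let $\mathcal S_k$ be the set of $k$-full integers that are not perfect $k$th powers. Let $$\Lambda_k=\Bigl\{(b_1^{k+1}b_2^{k+2}\cdots b_{k-1}^{2k-1})^{1/k}\ \Big|\ b_1,\dots,b_{k-1}\in\mathbb Z_{\ge1},\ b_1\cdots b_{k-1}\ge 2\text{ square-free}\Bigr\},$$ and for $\mathcal I\subseteq\Lambda_k$ put $\mathcal S_{\mathcal I}=\{a^k\lambda^k\mid a\in\mathbb Z_{\ge1},\ \lambda\in\mathcal I\}$. The asymptotic density of a set $\mathcal X$ of positive integers is $d(\mathcal X)=\lim_{x\to\infty}\#\{n\in\mathcal X\mid n\le x\}/x$, provided that the limit exists. For integers $\ell,m\ge 0$ let $$\mathcal A^{(k)}_{\ell,m}=\bigl\{n\in\mathbb Z_{\ge1}\ \big|\ \#\bigl((n^k,(n+1)^k)\cap\mathcal S_k\bigr)=\ell,\ \#\bigl(((n+1)^k,(n+2)^k)\cap\mathcal S_k\bigr)=m\bigr\},$$ and for disjoint finite sets $\mathcal I,\mathcal J\subseteq\Lambda_k$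 let $\mathcal B^{(k)}_{\mathcal I,\mathcal J}$ be the set of integers $n\ge1$ such that $\#\bigl((n^k,(n+1)^k)\cap\mathcal S_{\mathcal I}\bigr)=\#\mathcal I$, $\#\bigl(((n+1)^k,(n+2)^k)\cap\mathcal S_{\mathcal J}\bigr)=\#\mathcal J$ and $(n^k,(n+2)^k)\cap\mathcal S_{\Lambda_k\setminus(\mathcal I\cup\mathcal J)}=\varnothing$. Then: (i) For all disjoint finite sets $\mathcal I,\mathcal J\subseteq\Lambda_k$, the set $\mathcal B^{(k)}_{\mathcal I,\mathcal J}$ has positive asymptotic density $$d(\mathcal B^{(k)}_{\mathcal I,\mathcal J})=\prod_{\lambda\in\mathcal I\cup\mathcal J}\frac1\lambda\cdot\prod_{\lambda\in\Lambda_k\setminus(\mathcal I\cup\mathcal J)}\Bigl(1-\frac2\lambda\Bigr),$$ where the infinite product converges unconditionally. (ii) For all integers $\ell,m\ge0$, the set $\mathcal A^{(k)}_{\ell,m}$ has positive asymptotic density $$d(\mathcal A^{(k)}_{\ell,m})=\sum_{\substack{\mathcal I,\mathcal J\subseteq\Lambda_k\\ \#\mathcal I=\ell,\ \#\mathcal J=m,\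 \mathcal I\cap\mathcal J=\varnothing}}d(\mathcal B^{(k)}_{\mathcal I,\mathcal J}),$$ where the sum converges unconditionally. (iii) For all complex numbers $z,w$, $$\sum_{\ell,m\ge0}d(\mathcal A^{(k)}_{\ell,m})\,z^\ell w^m=\prod_{\lambda\in\Lambda_k}\Bigl(1+\frac{z+w-2}{\lambda}\Bigr),$$ where both the double series and the product converge unconditionally. -/

import Mathlib

open Filter Topology

namespace KFull

/-- A positive integer `n` is `k`-full if `p ^ k` divides `n` for every prime factor `p` of `n`. -/
def IsKFull (k n : ℕ) : Prop :=
  1 ≤ n ∧ ∀ p : ℕ, p.Prime → p ∣ n → p ^ k ∣ n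

/-- `S_k`: the `k`-full integers that are not perfect `k`-th powers. -/
def NonPowerKFull (k : ℕ) : Set ℕ :=
  {n | IsKFull k n ∧ ¬ ∃ a : ℕ, n = a ^ k}

/-- `Λ_k`: the real numbers `(b_1 ^ (k+1) ⋯ b_{k-1} ^ (2k-1)) ^ (1/k)`, where `b_1, …, b_{k-1}` are
positive integers with `b_1 ⋯ b_{k-1}` square-free and at least `2`. The index `j : Fin (k - 1)`
corresponds to `b_{j+1}`, whose exponent is `k + (j + 1)`. -/
def Lam (k : ℕ) : Set ℝ :=
  {x | ∃ b : Fin (k - 1) → ℕ, (∀ j, 1 ≤ b j) ∧ 2 ≤ ∏ j, b j ∧ Squarefree (∏ j, b j) ∧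
    x = (∏ j, (b j : ℝ) ^ (k + ((j : ℕ) + 1))) ^ (1 / (k : ℝ))}

/-- `S_I = {a ^ k * x ^ k | a ≥ 1, x ∈ I}`, as a set of natural numbers (for `I ⊆ Λ_k` all the
numbers `a ^ k * x ^ k` are positive integers). -/
def S (k : ℕ) (I : Set ℝ) : Set ℕ :=
  {n | ∃ a : ℕ, 1 ≤ a ∧ ∃ x ∈ I, (n : ℝ) = (a : ℝ) ^ k * x ^ k}

/-- `A_{l,m}^{(k)}`: the positive integers `n` such that `(n^k, (n+1)^k)` and `((n+1)^k, (n+2)^k)`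
contain exactly `l` and `m` elements of `S_k`, respectively. -/
def A (k l m : ℕ) : Set ℕ :=
  {n | 1 ≤ n ∧
    (Set.Ioo (n ^ k) ((n + 1) ^ k) ∩ NonPowerKFull k).ncard = l ∧
    (Set.Ioo ((n + 1) ^ k) ((n + 2) ^ k) ∩ NonPowerKFull k).ncard = m}

/-- `B_{I,J}^{(k)}` for finite sets `I, J ⊆ Λ_k`. -/
def B (k : ℕ) (I J : Finset ℝ) : Set ℕ :=
  {n | 1 ≤ n ∧
    (Set.Ioo (n ^ k) ((n + 1) ^ k) ∩ S k (I : Set ℝ)).ncard = I.card ∧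
    (Set.Ioo ((n + 1) ^ k) ((n + 2) ^ k) ∩ S k (J : Set ℝ)).ncard = J.card ∧
    Set.Ioo (n ^ k) ((n + 2) ^ k) ∩ S k (Lam k \ ((I : Set ℝ) ∪ (J : Set ℝ))) = ∅}

/-- The proportion `#X(x) / x`, where `#X(x)` counts the elements of `X` not exceeding `x`. -/
noncomputable def proportion (X : Set ℕ) (x : ℝ) : ℝ :=
  ({n : ℕ | n ∈ X ∧ (n : ℝ) ≤ x}.ncard : ℝ) / x

/-- The set `X` has asymptotic density `d`: the proportion tends to `d`. -/
def HasDensity (X : Set ℕ) (d : ℝ) : Prop :=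
  Tendsto (proportion X) atTop (𝓝 d)

/-- The asymptotic density of `X` (meaningful only if the limit exists). -/
noncomputable def density (X : Set ℕ) : ℝ :=
  limUnder atTop (proportion X)

/-- The pairs of disjoint sets `I, J ⊆ Λ_k` with `#I = l` and `#J = m`. -/
def DisjointPairs (k l m : ℕ) : Set (Finset ℝ × Finset ℝ) :=
  {p | (p.1 : Set ℝ) ⊆ Lam k ∧ (p.2 : Set ℝ) ⊆ Lam k ∧ p.1.card = l ∧ p.2.card = m ∧
    Disjoint p.1 p.2}

end KFull

namespace KFull

/-! A `k`-full number that is not a `k`-th power is `(a * x) ^ k` for exactly one pair of `a ≥ 1`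
and `x ∈ Λ_k`. After taking `k`-th roots, one therefore counts the `x ∈ Λ_k` with a multiple in `(n,
n + 1)` or in `(n + 1, n + 2)`. Every such `x` exceeds 2 and has no integral positive multiple, so
it has at most one multiple in `(n, n + 2)`, which is never `n + 1`. Hence each `n ≥ 1` determines a
pair `(I, J)` of disjoint finite sets, and the sets `HitPattern L I J` partition the positive
integers.

Whether `x` hits such an interval depends on which arc of the circle contains `n / x` modulo 1. Real
radicals with irrational ratios are linearly independent over `ℚ` (`linearIndependent_radicals`, by
taking traces), so `1` and the numbers `1 / x` are too. Weyl's theorem (`tendsto_orbitAverage`) then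
makes finitely many `x` behave independently, with probabilities `1 / x`, `1 / x` and `1 - 2 / x`.
The remaining `x` are hit for a proportion of `n` bounded by a multiple of the tail of `∑ 1 / x`,
which converges. This gives only lower bounds for the densities (`lowerDensityGE_hitPattern`).

No matching upper bound has to be proved: the expected densities add up to 1
(`hasSum_patternDensity_one`), so disjointness forces equality, even for arbitrary unions of
patterns (`hasDensity_biUnion`). Both `B` and `A` are such unions. The generating function comes
from `1 + (z + w - 2) / x = (1 - 2 / x) * (1 + (z + w) / (x - 2))`, by expanding the product of the
second factors over disjoint pairs `(I, J)`. -/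

/-! ### Linear independence of real radicals -/

/-- The trace of an irrational real number with a rational positive power vanishes. -/
theorem trace_eq_zero_of_pow_mem_range {K : IntermediateField ℚ ℝ} [FiniteDimensional ℚ K] (x : K)
    {n : ℕ} (hn : 0 < n) {c : ℚ} (hc : (x : ℝ) ^ n = c) (hx : Irrational (x : ℝ)) :
    Algebra.trace ℚ K x = 0 := by
  -- The trace is a multiple of the second coefficient of the minimal polynomial, which turns out to
  -- be `X ^ m - r` with `m ≥ 2`.
  rw [trace_eq_finrank_mul_minpoly_nextCoeff]
  have hint : IsIntegral ℚ x := .of_finite ℚ x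
  set m := (minpoly ℚ x).natDegree with hm
  have hmpos : 0 < m := minpoly.natDegree_pos hint
  have hm1 : m ≠ 1 := by
    intro h
    obtain ⟨q, hq⟩ := minpoly.natDegree_eq_one_iff.mp (hm ▸ h)
    exact hx ⟨q, by rw [← hq]; simp⟩
  -- the norm from `ℚ(x)` gives a rational value of `x ^ m`, up to sign
  set g := IntermediateField.AdjoinSimple.gen ℚ x
  have hg : g ^ n = algebraMap ℚ _ c := by
    apply Subtype.ext
    apply Subtype.ext
    simpa [g] using hc
  have hfin : Module.finrank ℚ (IntermediateField.adjoin ℚ {x}) = m :=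
    IntermediateField.adjoin.finrank hint
  have hnorm : (Algebra.norm ℚ g) ^ n = c ^ m := by
    rw [← map_pow, hg, Algebra.norm_algebraMap, hfin]
  have habs : |(x : ℝ) ^ m| = |((Algebra.norm ℚ g : ℚ) : ℝ)| := by
    have h1 : |(x : ℝ) ^ m| ^ n = |((Algebra.norm ℚ g : ℚ) : ℝ)| ^ n := by
      rw [← abs_pow, ← abs_pow, ← pow_mul, mul_comm m n, pow_mul, hc]
      exact_mod_cast congrArg (fun t : ℚ => |(t : ℝ)|) hnorm.symm
    exact (pow_left_inj₀ (abs_nonneg _) (abs_nonneg _) hn.ne').mp h1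
  obtain ⟨r, hr⟩ : ∃ r : ℚ, (x : ℝ) ^ m = r := by
    rcases abs_eq_abs.mp habs with h | h
    · exact ⟨_, h⟩
    · exact ⟨-Algebra.norm ℚ g, by rw [h]; push_cast; rfl⟩
  have hmin : minpoly ℚ x = Polynomial.X ^ m - Polynomial.C r := by
    symm
    apply minpoly.unique' ℚ x (Polynomial.monic_X_pow_sub_C r hmpos.ne')
    · have : x ^ m = algebraMap ℚ K r := by
        apply Subtype.ext
        simpa using hr
      simp [this]
    · intro q hq
      by_cases h0 : q = 0
      · exact .inl h0
      right
      intro hq0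
      have h1 := minpoly.degree_le_of_ne_zero ℚ x h0 hq0
      rw [Polynomial.degree_X_pow_sub_C hmpos] at hq
      rw [Polynomial.degree_eq_natDegree (minpoly.ne_zero hint), ← hm] at h1
      exact absurd (lt_of_le_of_lt h1 hq) (lt_irrefl _)
  have hnc : (minpoly ℚ x).nextCoeff = 0 := by
    rw [Polynomial.nextCoeff_of_natDegree_pos (hm ▸ hmpos), ← hm, hmin]
    rw [Polynomial.coeff_sub, Polynomial.coeff_X_pow, Polynomial.coeff_C]
    rw [if_neg (by omega), if_neg (by omega), sub_zero]
  simp [hnc]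

/-- Real radicals with pairwise irrational ratios are linearly independent over `ℚ`. -/
theorem linearIndependent_radicals {ι : Type*} (α : ι → ℝ) {n : ℕ} (hn : 0 < n)
    (hpow : ∀ i, ∃ c : ℚ, α i ^ n = c) (h0 : ∀ i, α i ≠ 0)
    (hirr : ∀ i j, i ≠ j → Irrational (α i / α j)) : LinearIndependent ℚ α := by
  classical
  rw [linearIndependent_iff']
  intro s c hsum j hj
  have hpow' : ∀ i, ∃ c : ℚ, (α i / α j) ^ n = c := by
    intro i
    obtain ⟨a, ha⟩ := hpow i
    obtain ⟨b, hb⟩ := hpow j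
    exact ⟨a / b, by rw [div_pow, ha, hb]; push_cast; rfl⟩
  -- Divide the relation by `α j` and take the trace from the field generated by the ratios: only
  -- the term `i = j` survives.
  let T : Set ℝ := (fun i => α i / α j) '' (s : Set ι)
  have hT : Finite T := (s.finite_toSet.image _)
  have hfd : FiniteDimensional ℚ (IntermediateField.adjoin ℚ T) := by
    apply IntermediateField.finiteDimensional_adjoin
    rintro _ ⟨i, -, rfl⟩
    obtain ⟨q, hq⟩ := hpow' i
    refine IsIntegral.of_pow hn ?_
    rw [hq]
    exact isIntegral_algebraMap (R := ℚ) (A := ℝ) (x := q)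
  have hmem : ∀ i : s, α i / α j ∈ IntermediateField.adjoin ℚ T := fun i =>
    IntermediateField.subset_adjoin ℚ T ⟨i, i.2, rfl⟩
  let y : s → IntermediateField.adjoin ℚ T := fun i => ⟨α i / α j, hmem i⟩
  have hsum' : ∑ i : s, c i • y i = 0 := by
    apply Subtype.ext
    have : (∑ i ∈ s, c i • α i) / α j = 0 := by rw [hsum, zero_div]
    rw [Finset.sum_div, ← Finset.sum_coe_sort] at this
    push_cast
    rw [← this]
    simp [y, Rat.smul_def, mul_div_assoc]
  have htr := congrArg (Algebra.trace ℚ (IntermediateField.adjoin ℚ T)) hsum'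
  rw [map_sum, map_zero, Finset.sum_eq_single (⟨j, hj⟩ : s)] at htr
  · have hy : y ⟨j, hj⟩ = 1 := Subtype.ext (div_self (h0 j))
    rw [hy, map_smul, ← map_one (algebraMap ℚ _), Algebra.trace_algebraMap] at htr
    simpa [Module.finrank_pos.ne'] using htr
  · intro i _ hi
    obtain ⟨q, hq⟩ := hpow' i
    rw [map_smul, trace_eq_zero_of_pow_mem_range (y i) hn hq, smul_zero]
    exact hirr i j fun h => hi (Subtype.ext h)
  · simp

/-! ### The integers `x ^ k`, `x ∈ Λ_k`, and `k`-full numbers -/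

/-- The natural numbers all of whose positive `p`-adic valuations lie strictly between `k`
and `2 * k`. -/
def IsCore (k N : ℕ) : Prop :=
  N ≠ 0 ∧ ∀ p, N.factorization p = 0 ∨ k < N.factorization p ∧ N.factorization p < 2 * k

theorem isCore_one (k : ℕ) : IsCore k 1 := ⟨one_ne_zero, fun p => .inl (by simp)⟩

/-- At each prime the valuations of `N` and `N'` agree modulo `k`, and `{0} ∪ (k, 2k)` contains at
most one integer of each residue class. This is the uniqueness behind all later comparisons of
multiples. -/
theorem IsCore.eq_of_pow_mul_eq {k N N' d e : ℕ} (hN : IsCore k N) (hN' : IsCore k N')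
    (hd : d ≠ 0) (he : e ≠ 0) (h : d ^ k * N = e ^ k * N') : N = N' := by
  apply Nat.eq_of_factorization_eq hN.1 hN'.1
  intro p
  have h1 := congrArg (fun n => n.factorization p) h
  simp only [Nat.factorization_mul (pow_ne_zero k hd) hN.1,
    Nat.factorization_mul (pow_ne_zero k he) hN'.1, Nat.factorization_pow, Finsupp.add_apply,
    Finsupp.smul_apply, smul_eq_mul] at h1
  set u := d.factorization p
  set v := e.factorization p
  have key : ∀ a b c d : ℕ, k * a + c = k * b + d → c < d + k → d < c + k → c = d := by
    intro a b c d h2 h3 h4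
    rcases lt_trichotomy a b with hab | hab | hab
    · obtain ⟨t, rfl⟩ := Nat.exists_eq_add_of_lt hab
      have : k * (a + t + 1) = k * a + k * t + k := by ring
      have := Nat.zero_le (k * t)
      omega
    · subst hab; omega
    · obtain ⟨t, rfl⟩ := Nat.exists_eq_add_of_lt hab
      have : k * (b + t + 1) = k * b + k * t + k := by ring
      have := Nat.zero_le (k * t)
      omega
  have key0 : ∀ a b c : ℕ, k * a = k * b + c → k < c → c < 2 * k → False := by
    intro a b c h2 h3 h4
    have h5 : k ∣ c := (Nat.dvd_add_right (Dvd.intro b rfl)).mp (h2 ▸ Dvd.intro a rfl)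
    obtain ⟨t, rfl⟩ := h5
    have hk0 : 0 < k := by by_contra h; simp_all
    have : 1 < t := by by_contra h; have : t ≤ 1 := by omega
                       nlinarith
    nlinarith
  rcases hN.2 p with ha | ⟨ha, ha'⟩ <;> rcases hN'.2 p with hb | ⟨hb, hb'⟩
  · rw [ha, hb]
  · exact (key0 u v _ (by omega) hb hb').elim
  · exact (key0 v u _ (by omega) ha ha').elim
  · exact key u v _ _ h1 (by omega) (by omega)

theorem rpow_inv_pow {k : ℕ} (hk : k ≠ 0) (N : ℕ) : ((N : ℝ) ^ (1 / (k : ℝ))) ^ k = N := by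
  rw [one_div]
  exact Real.rpow_inv_natCast_pow (Nat.cast_nonneg N) hk

theorem isCore_of_tuple {k : ℕ} (b : Fin (k - 1) → ℕ) (hb : ∀ j, 1 ≤ b j)
    (hs : Squarefree (∏ j, b j)) : IsCore k (∏ j, b j ^ (k + ((j : ℕ) + 1))) := by
  have hb0 : ∀ j, b j ≠ 0 := fun j => by have := hb j; omega
  refine ⟨Finset.prod_ne_zero_iff.mpr fun j _ => pow_ne_zero _ (hb0 j), fun p => ?_⟩
  rw [Nat.factorization_prod fun j _ => pow_ne_zero _ (hb0 j)]
  have h1 := hs.natFactorization_le_one p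
  rw [Nat.factorization_prod fun j _ => hb0 j, Finsupp.finsetSum_apply] at h1
  simp only [Finsupp.finsetSum_apply, Nat.factorization_pow, Finsupp.smul_apply, smul_eq_mul]
  by_cases h0 : ∀ j, (b j).factorization p = 0
  · left; simp [h0]
  · right
    push Not at h0
    obtain ⟨j, hj⟩ := h0
    have hz : ∀ i, i ≠ j → (b i).factorization p = 0 := by
      intro i hij
      have := Finset.add_le_sum (f := fun i => (b i).factorization p) (s := Finset.univ)
        (fun _ _ => Nat.zero_le _) (Finset.mem_univ i) (Finset.mem_univ j) hij
      omega
    have hj1 : (b j).factorization p = 1 := by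
      have := Finset.single_le_sum (f := fun i => (b i).factorization p) (s := Finset.univ)
        (fun _ _ => Nat.zero_le _) (Finset.mem_univ j)
      omega
    rw [Finset.sum_eq_single j (fun i _ hi => by rw [hz i hi, mul_zero]) (by simp), hj1]
    have := j.2
    omega

/-- Sort the primes of `N` by exponent: `b j` is the product of those with exponent `k + j + 1`. -/
theorem IsCore.exists_tuple {k N : ℕ} (hN : IsCore k N) : ∃ b : Fin (k - 1) → ℕ, (∀ j, 1 ≤ b j) ∧
    ∏ j, b j = ∏ p ∈ N.primeFactors, p ∧ ∏ j, b j ^ (k + ((j : ℕ) + 1)) = N := by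
  classical
  by_cases hk : k ≤ 1
  · have hN1 : N.primeFactors = ∅ := by
      rw [Finset.eq_empty_iff_forall_notMem]
      intro p hp
      have h1 := (Nat.prime_of_mem_primeFactors hp).factorization_pos_of_dvd hN.1
        (Nat.dvd_of_mem_primeFactors hp)
      rcases hN.2 p with h | ⟨h, h'⟩ <;> omega
    have hN2 : N = 1 := by
      rcases Nat.primeFactors_eq_empty.mp hN1 with h | h
      · exact absurd h hN.1
      · exact h
    subst hN2
    have he : IsEmpty (Fin (k - 1)) := by rw [show k - 1 = 0 by omega]; infer_instance
    exact ⟨fun _ => 1, by simp, by simp, by simp⟩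
  -- The remainder only makes `g` total; on prime factors of `N` it changes nothing.
  let g : ℕ → Fin (k - 1) := fun p => ⟨(N.factorization p - k - 1) % (k - 1),
    Nat.mod_lt _ (by omega)⟩
  have hg : ∀ p ∈ N.primeFactors, k + ((g p : ℕ) + 1) = N.factorization p := by
    intro p hp
    have h1 := (Nat.prime_of_mem_primeFactors hp).factorization_pos_of_dvd hN.1
      (Nat.dvd_of_mem_primeFactors hp)
    rcases hN.2 p with h | ⟨h, h'⟩
    · omega
    · simp only [g]
      rw [Nat.mod_eq_of_lt (by omega)]
      omega
  refine ⟨fun j => ∏ p ∈ N.primeFactors with g p = j, p, fun j => ?_, ?_, ?_⟩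
  · exact Finset.prod_pos fun p hp => Nat.pos_of_mem_primeFactors (Finset.mem_filter.mp hp).1
  · exact Finset.prod_fiberwise _ _ _
  · conv_rhs => rw [← Nat.prod_factorization_pow_eq_self hN.1, Finsupp.prod,
      Nat.support_factorization, ← Finset.prod_fiberwise _ g]
    refine Finset.prod_congr rfl fun j _ => ?_
    rw [← Finset.prod_pow]
    refine Finset.prod_congr rfl fun p hp => ?_
    obtain ⟨hp1, rfl⟩ := Finset.mem_filter.mp hp
    rw [hg p hp1]

/-- Replaces the tuple by the single integer `N = x ^ k`, whose valuations can be compared directly.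
-/
theorem mem_Lam_iff {k : ℕ} (x : ℝ) :
    x ∈ Lam k ↔ ∃ N : ℕ, 2 ≤ N ∧ IsCore k N ∧ x = (N : ℝ) ^ (1 / (k : ℝ)) := by
  constructor
  · rintro ⟨b, hb, h2, hs, rfl⟩
    refine ⟨∏ j, b j ^ (k + ((j : ℕ) + 1)), ?_, isCore_of_tuple b hb hs, by push_cast; rfl⟩
    exact h2.trans (Finset.prod_le_prod' fun j _ => Nat.le_self_pow (by omega) _)
  · rintro ⟨N, h2, hN, rfl⟩
    obtain ⟨b, hb, hprod, hpow⟩ := hN.exists_tuple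
    refine ⟨b, hb, ?_, ?_, by rw [← hpow]; push_cast; rfl⟩
    · rw [hprod]
      obtain ⟨p, hp, hpN⟩ := Nat.exists_prime_and_dvd (show N ≠ 1 by omega)
      exact hp.two_le.trans (Nat.le_of_dvd (Finset.prod_pos fun q hq =>
        Nat.pos_of_mem_primeFactors hq)
        (Finset.dvd_prod_of_mem _ (Nat.mem_primeFactors.mpr ⟨hp, hpN, hN.1⟩)))
    · rw [hprod]
      exact (Finset.squarefree_prod_of_pairwise_isCoprime
        (fun p hp q hq hpq => Nat.coprime_iff_isRelPrime.mp
          ((Nat.coprime_primes (Nat.prime_of_mem_primeFactors hp)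
          (Nat.prime_of_mem_primeFactors hq)).mpr hpq))
        fun p hp => (Nat.prime_of_mem_primeFactors hp).squarefree)

theorem eq_of_mul_rpow_eq {k N N' d e : ℕ} (hk : k ≠ 0) (hN : IsCore k N) (hN' : IsCore k N')
    (hd : d ≠ 0) (he : e ≠ 0)
    (h : (d : ℝ) * (N : ℝ) ^ (1 / (k : ℝ)) = e * (N' : ℝ) ^ (1 / (k : ℝ))) : N = N' := by
  have := congrArg (· ^ k) h
  simp only [mul_pow, rpow_inv_pow hk] at this
  exact hN.eq_of_pow_mul_eq hN' hd he (by exact_mod_cast this)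

/-- A rational ratio `u / v` would give `v * N ^ (1/k) = u * N' ^ (1/k)`, against uniqueness. -/
theorem irrational_rpow_div {k N N' : ℕ} (hk : k ≠ 0) (hN : IsCore k N) (hN' : IsCore k N')
    (hne : N ≠ N') : Irrational ((N : ℝ) ^ (1 / (k : ℝ)) / (N' : ℝ) ^ (1 / (k : ℝ))) := by
  rintro ⟨q, hq⟩
  have h1 : (0 : ℝ) < (N : ℝ) ^ (1 / (k : ℝ)) :=
    Real.rpow_pos_of_pos (by exact_mod_cast Nat.pos_of_ne_zero hN.1) _
  have h2 : (0 : ℝ) < (N' : ℝ) ^ (1 / (k : ℝ)) :=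
    Real.rpow_pos_of_pos (by exact_mod_cast Nat.pos_of_ne_zero hN'.1) _
  have hq0 : 0 < q := by
    have : (0 : ℝ) < q := hq ▸ div_pos h1 h2
    exact_mod_cast this
  have hnum : ((q.num.toNat : ℕ) : ℝ) = q * q.den := by
    have h3 : ((q.num.toNat : ℕ) : ℤ) = q.num := Int.toNat_of_nonneg (Rat.num_pos.mpr hq0).le
    have h4 : ((q.num.toNat : ℕ) : ℝ) = (q.num : ℝ) := by exact_mod_cast h3
    rw [h4]
    exact_mod_cast (Rat.mul_den_eq_num q).symm
  refine hne (eq_of_mul_rpow_eq (d := q.den) (e := q.num.toNat) hk hN hN' q.den_nz ?_ ?_)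
  · have := Rat.num_pos.mpr hq0; omega
  · rw [hnum, hq]
    field_simp

/-- Some prime occurs in `x ^ k` with exponent above `k`, so `x ^ k > 2 ^ k`. The bound keeps `1 - 2
/ x` positive and multiples of `x` more than 2 apart. -/
theorem two_lt_of_mem_Lam {k : ℕ} (hk : 2 ≤ k) {x : ℝ} (hx : x ∈ Lam k) : 2 < x := by
  obtain ⟨N, h2, hN, rfl⟩ := (mem_Lam_iff x).mp hx
  have hlt : 2 ^ k < N := by
    obtain ⟨p, hp, hpN⟩ := Nat.exists_prime_and_dvd (show N ≠ 1 by omega)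
    have h1 := hp.factorization_pos_of_dvd hN.1 hpN
    rcases hN.2 p with h | ⟨h, -⟩
    · omega
    · calc 2 ^ k < 2 ^ N.factorization p := Nat.pow_lt_pow_right (by norm_num) h
        _ ≤ p ^ N.factorization p := Nat.pow_le_pow_left hp.two_le _
        _ ≤ N := Nat.le_of_dvd (Nat.pos_of_ne_zero hN.1) (Nat.ordProj_dvd N p)
  have h3 : (2 : ℝ) ^ k < ((N : ℝ) ^ (1 / (k : ℝ))) ^ k := by
    rw [rpow_inv_pow (by omega)]
    exact_mod_cast hlt
  exact lt_of_pow_lt_pow_left₀ k (by positivity) h3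

/-- Multiples of distinct elements of `Λ_k` are distinct. -/
theorem Lam_eq_of_mul_eq {k : ℕ} (hk : k ≠ 0) {x y : ℝ} (hx : x ∈ Lam k) (hy : y ∈ Lam k)
    {a b : ℕ} (ha : a ≠ 0) (hb : b ≠ 0) (h : (a : ℝ) * x = b * y) : x = y := by
  obtain ⟨N, -, hN, rfl⟩ := (mem_Lam_iff x).mp hx
  obtain ⟨N', -, hN', rfl⟩ := (mem_Lam_iff y).mp hy
  rw [eq_of_mul_rpow_eq hk hN hN' ha hb h]

theorem Lam_mul_ne_natCast {k : ℕ} (hk : k ≠ 0) {x : ℝ} (hx : x ∈ Lam k) {a : ℕ} (ha : a ≠ 0)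
    (n : ℕ) : (a : ℝ) * x ≠ n := by
  obtain ⟨N, h2, hN, rfl⟩ := (mem_Lam_iff x).mp hx
  intro h
  have hn : n ≠ 0 := by
    rintro rfl
    have : (0 : ℝ) < (a : ℝ) * (N : ℝ) ^ (1 / (k : ℝ)) :=
      mul_pos (by exact_mod_cast Nat.pos_of_ne_zero ha)
        (Real.rpow_pos_of_pos (by exact_mod_cast Nat.pos_of_ne_zero hN.1) _)
    rw [h, Nat.cast_zero] at this
    exact lt_irrefl _ this
  have := eq_of_mul_rpow_eq (N' := 1) hk hN (isCore_one k) ha hn (by simpa using h)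
  omega

/-- The reciprocals of the elements of `Λ_k`, together with `1`, are linearly independent. -/
theorem linearIndependent_inv_Lam {k : ℕ} (hk : k ≠ 0) :
    LinearIndependent ℚ (fun o : Option (Lam k) => o.elim (1 : ℝ) fun x => 1 / (x : ℝ)) := by
  -- The constant `1` joins the family as the radical with core `N = 1`.
  have hex : ∀ o : Option (Lam k), ∃ N : ℕ, IsCore k N ∧
      o.elim (1 : ℝ) (fun x => 1 / (x : ℝ)) = 1 / (N : ℝ) ^ (1 / (k : ℝ)) ∧
      (o = none ∧ N = 1 ∨ ∃ x : Lam k, o = some x ∧ 2 ≤ N ∧ (x : ℝ) = (N : ℝ) ^ (1 / (k : ℝ))) := by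
    rintro (_ | x)
    · exact ⟨1, isCore_one k, by simp, .inl ⟨rfl, rfl⟩⟩
    · obtain ⟨N, h2, hN, hx⟩ := (mem_Lam_iff (x : ℝ)).mp x.2
      exact ⟨N, hN, by simp [hx], .inr ⟨x, rfl, h2, hx⟩⟩
  choose N hN hval hcase using hex
  have hinj : Function.Injective N := by
    intro o o' h
    rcases hcase o with ⟨rfl, h1⟩ | ⟨x, rfl, h1, hx⟩ <;>
      rcases hcase o' with ⟨rfl, h2⟩ | ⟨y, rfl, h2, hy⟩
    · rfl
    · omega
    · omega
    · rw [h, ← hy] at hx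
      rw [Subtype.ext hx]
  have hpos : ∀ o, (0 : ℝ) < (N o : ℝ) ^ (1 / (k : ℝ)) := fun o =>
    Real.rpow_pos_of_pos (by exact_mod_cast Nat.pos_of_ne_zero (hN o).1) _
  simp_rw [funext hval]
  refine linearIndependent_radicals _ (Nat.pos_of_ne_zero hk) (fun o => ⟨1 / (N o : ℚ), ?_⟩)
    (fun o => (one_div_pos.mpr (hpos o)).ne') fun o o' h => ?_
  · rw [div_pow, rpow_inv_pow hk]; simp
  · have := irrational_rpow_div hk (hN o') (hN o) fun h' => h (hinj h').symm
    rwa [div_div_div_eq, one_mul, mul_one]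

/-- The numbers `p ^ ((k + 1) / k)` with `p` prime suffice, since `k + 1 < 2 * k`. -/
theorem Lam_infinite {k : ℕ} (hk : 2 ≤ k) : (Lam k).Infinite := by
  have hmem : ∀ p : {p : ℕ // p.Prime}, ((p.1 ^ (k + 1) : ℕ) : ℝ) ^ (1 / (k : ℝ)) ∈ Lam k := by
    intro p
    refine (mem_Lam_iff _).mpr ⟨p.1 ^ (k + 1), p.2.two_le.trans (Nat.le_self_pow (by omega) _),
      ⟨pow_ne_zero _ p.2.ne_zero, fun q => ?_⟩, rfl⟩
    rw [p.2.factorization_pow, Finsupp.single_apply]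
    split_ifs
    · right; omega
    · left; rfl
  have : Infinite {p : ℕ // p.Prime} := Nat.infinite_setOfPred_prime.to_subtype
  refine (Set.infinite_range_of_injective (f := fun p : {p : ℕ // p.Prime} =>
    ((p.1 ^ (k + 1) : ℕ) : ℝ) ^ (1 / (k : ℝ))) ?_).mono (by rintro _ ⟨p, rfl⟩; exact hmem p)
  intro p q h
  have h1 := congrArg (· ^ k) h
  simp only [rpow_inv_pow (show k ≠ 0 by omega)] at h1
  exact Subtype.ext (Nat.pow_left_injective (by omega : k + 1 ≠ 0) (by exact_mod_cast h1))

/-- All exponents are at least `k + 1`, so `x ≥ ∏ b j ^ (1 + 1/k)`, and the sum is dominated by a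
product of `k - 1` convergent zeta series. -/
theorem summable_inv_Lam {k : ℕ} (hk : k ≠ 0) : Summable fun x : Lam k => 1 / (x : ℝ) := by
  have hf0 : ∀ m : ℕ, 0 ≤ 1 / (m : ℝ) ^ (1 + 1 / (k : ℝ)) := fun m => by positivity
  have hf : Summable fun m : ℕ => 1 / (m : ℝ) ^ (1 + 1 / (k : ℝ)) :=
    Real.summable_one_div_nat_rpow.mpr (by
      have : (0 : ℝ) < k := by exact_mod_cast Nat.pos_of_ne_zero hk
      have := one_div_pos.mpr this
      linarith)
  have hprod : Summable fun b : Fin (k - 1) → ℕ => ∏ j, 1 / (b j : ℝ) ^ (1 + 1 / (k : ℝ)) := by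
    refine summable_of_sum_le (fun b => Finset.prod_nonneg fun j _ => hf0 _)
      (c := ∏ _j : Fin (k - 1), ∑' m : ℕ, 1 / (m : ℝ) ^ (1 + 1 / (k : ℝ))) fun u => ?_
    classical
    calc _ ≤ ∑ b ∈ Fintype.piFinset fun j => u.image fun b : Fin (k - 1) → ℕ => b j,
          ∏ j, 1 / ((b j : ℕ) : ℝ) ^ (1 + 1 / (k : ℝ)) := by
          refine Finset.sum_le_sum_of_subset_of_nonneg (fun b hb => ?_)
            fun b _ _ => Finset.prod_nonneg fun j _ => hf0 _
          exact Fintype.mem_piFinset.mpr fun j => Finset.mem_image_of_mem _ hb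
      _ = ∏ j, ∑ m ∈ u.image fun b : Fin (k - 1) → ℕ => b j,
          1 / ((m : ℕ) : ℝ) ^ (1 + 1 / (k : ℝ)) :=
          (Finset.prod_univ_sum _ fun _ (m : ℕ) => 1 / (m : ℝ) ^ (1 + 1 / (k : ℝ))).symm
      _ ≤ _ := Finset.prod_le_prod (fun j _ => Finset.sum_nonneg fun m _ => hf0 m)
          fun j _ => hf.sum_le_tsum _ fun m _ => hf0 m
  choose b hb1 _ _ hbx using fun x : Lam k => x.2
  have hinj : Function.Injective b := fun x y h => Subtype.ext (by rw [hbx x, hbx y, h])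
  refine (hprod.comp_injective hinj).of_nonneg_of_le (fun x => ?_) fun x => ?_
  · rw [hbx x]; positivity
  · have hk' : (0 : ℝ) < k := by exact_mod_cast Nat.pos_of_ne_zero hk
    rw [hbx x, ← Real.finsetProd_rpow _ _ (fun j _ => by positivity), one_div (∏ _, _),
      ← Finset.prod_inv_distrib]
    refine Finset.prod_le_prod (fun j _ => by positivity) fun j _ => ?_
    have h1 : (1 : ℝ) ≤ b x j := by exact_mod_cast hb1 x j
    rw [one_div (_ ^ (1 + _)), ← Real.rpow_natCast, ← Real.rpow_mul (by positivity)]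
    refine inv_anti₀ (by positivity) (Real.rpow_le_rpow_of_exponent_le h1 ?_)
    push_cast
    rw [mul_one_div, le_div_iff₀ hk', add_mul, one_mul, one_div_mul_cancel hk'.ne']
    have : (0 : ℝ) ≤ ((j : ℕ) : ℝ) := by positivity
    linarith

/-- The `k`-full integers that are not `k`-th powers are the `a ^ k * x ^ k` with `x ∈ Λ_k`. -/
theorem nonPowerKFull_eq {k : ℕ} (hk : k ≠ 0) : NonPowerKFull k = S k (Lam k) := by
  ext n
  constructor
  · rintro ⟨⟨hn1, hfull⟩, hnp⟩
    have hn0 : n ≠ 0 := by omega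
    let v := n.factorization
    -- `r p` represents `v p` modulo `k` in `{0} ∪ (k, 2k)`. Unless `k ∣ v p`, this takes one `k`
    -- back from the quotient, which `v p ≥ k` allows.
    let r : ℕ → ℕ := fun p => if k ∣ v p then 0 else k + v p % k
    let s : ℕ → ℕ := fun p => if k ∣ v p then v p / k else v p / k - 1
    have hv : ∀ p ∈ n.primeFactors, k ≤ v p := fun p hp =>
      ((Nat.prime_of_mem_primeFactors hp).pow_dvd_iff_le_factorization hn0).mp
        (hfull p (Nat.prime_of_mem_primeFactors hp) (Nat.dvd_of_mem_primeFactors hp))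
    have hrs : ∀ p ∈ n.primeFactors, s p * k + r p = v p := by
      intro p hp
      simp only [r, s]
      split_ifs with h
      · rw [Nat.div_mul_cancel h, add_zero]
      · have h1 := Nat.div_add_mod (v p) k
        obtain ⟨t, ht⟩ : ∃ t, v p / k = t + 1 :=
          Nat.exists_eq_succ_of_ne_zero (Nat.div_pos (hv p hp) (Nat.pos_of_ne_zero hk)).ne'
        rw [ht] at h1 ⊢
        rw [Nat.add_sub_cancel]
        have : k * (t + 1) = t * k + k := by ring
        omega
    let N := ∏ p ∈ n.primeFactors, p ^ r p
    let a := ∏ p ∈ n.primeFactors, p ^ s p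
    have hprime : ∀ p ∈ n.primeFactors, p.Prime := fun p hp => Nat.prime_of_mem_primeFactors hp
    have hN0 : N ≠ 0 := Finset.prod_ne_zero_iff.mpr fun p hp => pow_ne_zero _ (hprime p hp).ne_zero
    have ha0 : a ≠ 0 := Finset.prod_ne_zero_iff.mpr fun p hp => pow_ne_zero _ (hprime p hp).ne_zero
    have hn : n = a ^ k * N := by
      simp only [a, N]
      rw [← Finset.prod_pow, ← Finset.prod_mul_distrib]
      conv_lhs => rw [← Nat.prod_factorization_pow_eq_self hn0, Finsupp.prod,
        Nat.support_factorization]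
      refine Finset.prod_congr rfl fun p hp => ?_
      rw [← pow_mul, ← pow_add, hrs p hp]
    have hN : IsCore k N := by
      refine ⟨hN0, fun q => ?_⟩
      rw [Nat.factorization_prod fun p hp => pow_ne_zero _ (hprime p hp).ne_zero,
        Finsupp.finsetSum_apply]
      by_cases hq : q ∈ n.primeFactors
      · rw [Finset.sum_eq_single q]
        · rw [(hprime q hq).factorization_pow, Finsupp.single_eq_same]
          simp only [r]
          split_ifs with h
          · exact .inl rfl
          · right
            have h1 : v q % k ≠ 0 := fun h' => h (Nat.dvd_of_mod_eq_zero h')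
            have h2 := Nat.mod_lt (v q) (Nat.pos_of_ne_zero hk)
            omega
        · intro p hp hpq
          rw [(hprime p hp).factorization_pow, Finsupp.single_eq_of_ne hpq.symm]
        · exact fun h => absurd hq h
      · left
        refine Finset.sum_eq_zero fun p hp => ?_
        rw [(hprime p hp).factorization_pow, Finsupp.single_eq_of_ne]
        rintro rfl
        exact hq hp
    have hN2 : 2 ≤ N := by
      by_contra h
      have : N = 1 := by omega
      exact hnp ⟨a, by rw [hn, this, mul_one]⟩
    refine ⟨a, by omega, (N : ℝ) ^ (1 / (k : ℝ)), (mem_Lam_iff _).mpr ⟨N, hN2, hN, rfl⟩, ?_⟩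
    rw [rpow_inv_pow hk]
    exact_mod_cast hn
  · rintro ⟨a, ha, x, hx, h⟩
    obtain ⟨N, h2, hN, rfl⟩ := (mem_Lam_iff x).mp hx
    rw [rpow_inv_pow hk] at h
    have hn : n = a ^ k * N := by exact_mod_cast h
    refine ⟨⟨?_, fun p hp hpn => ?_⟩, ?_⟩
    · rw [hn]
      exact Nat.mul_pos (Nat.pow_pos ha) (by omega)
    · rw [hn] at hpn ⊢
      rcases hp.dvd_mul.mp hpn with h1 | h1
      · exact Dvd.dvd.mul_right (pow_dvd_pow_of_dvd (hp.dvd_of_dvd_pow h1) k) _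
      · refine Dvd.dvd.mul_left ((hp.pow_dvd_iff_le_factorization hN.1).mpr ?_) _
        have h3 := hp.factorization_pos_of_dvd hN.1 h1
        rcases hN.2 p with h4 | ⟨h4, -⟩ <;> omega
    · rintro ⟨c, hc⟩
      have hc0 : c ≠ 0 := by
        rintro rfl
        rw [hc, zero_pow hk] at hn
        have := Nat.mul_pos (Nat.pow_pos (n := k) ha) (show 0 < N by omega)
        omega
      have := hN.eq_of_pow_mul_eq (isCore_one k) (show a ≠ 0 by omega) hc0
        (by rw [← hn, hc, mul_one])
      omega

/-! ### Equidistribution of linear orbits on the torus -/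

section Weyl

open MeasureTheory AddCircle

variable {d : Type*}

/-- The `n`-th point `n • θ` of a linear orbit on the torus. -/
noncomputable def orbit (θ : d → ℝ) (n : ℕ) : UnitAddTorus d :=
  fun i => (((n : ℝ) * θ i : ℝ) : UnitAddCircle)

/-- The average of `f` over the first `N` points of an orbit. -/
noncomputable def orbitAverage (θ : d → ℝ) (N : ℕ) (f : UnitAddTorus d → ℂ) : ℂ :=
  (∑ n ∈ Finset.Icc 1 N, f (orbit θ n)) / N

/-- A bound uniform in `N`, so that convergence of averages passes from trigonometric polynomials to
their uniform closure. -/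
theorem norm_orbitAverage_sub_le (θ : d → ℝ) (N : ℕ) (f g : C(UnitAddTorus d, ℂ)) :
    ‖orbitAverage θ N f - orbitAverage θ N g‖ ≤ ‖f - g‖ := by
  rw [orbitAverage, orbitAverage, ← sub_div, ← Finset.sum_sub_distrib, norm_div]
  rcases Nat.eq_zero_or_pos N with rfl | hN
  · simp
  · rw [RCLike.norm_natCast, div_le_iff₀ (by exact_mod_cast hN)]
    refine (norm_sum_le _ _).trans ?_
    calc _ ≤ ∑ _n ∈ Finset.Icc 1 N, ‖f - g‖ :=
          Finset.sum_le_sum fun n _ => (f - g).norm_coe_le_norm (orbit θ n)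
      _ = ‖f - g‖ * N := by simp [mul_comm]

variable [Fintype d]

/-- The Haar probability measure on the torus, as a product measure. -/
noncomputable def torusMeasure (d : Type*) [Fintype d] : Measure (UnitAddTorus d) :=
  Measure.pi fun _ : d => (haarAddCircle : Measure UnitAddCircle)

instance : IsProbabilityMeasure (torusMeasure d) := by
  unfold torusMeasure; infer_instance

theorem integral_mFourier (m : d → ℤ) :
    ∫ x, UnitAddTorus.mFourier m x ∂(torusMeasure d) = if m = 0 then 1 else 0 := by
  classical
  have h1 : ∀ j : ℤ, ∫ x : UnitAddCircle, fourier j x ∂haarAddCircle = if j = 0 then 1 else 0 := by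
    intro j
    have := congrFun (fourierCoeff_fourier (T := 1) j) 0
    rw [fourierCoeff] at this
    simp only [neg_zero, fourier_zero, one_smul] at this
    rw [this, Pi.single_apply]
    simp [eq_comm]
  have h2 := integral_fintype_prod_eq_prod (𝕜 := ℂ)
    (μ := fun _ : d => (haarAddCircle : Measure UnitAddCircle)) (fun i x => fourier (m i) x)
  rw [torusMeasure]
  refine (h2.trans (Finset.prod_congr rfl fun i _ => h1 (m i))).trans ?_
  split_ifs with h
  · simp [h]
  · obtain ⟨i, hi⟩ := Function.ne_iff.mp h
    exact Finset.prod_eq_zero (Finset.mem_univ i) (if_neg hi)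

/-- For `m ≠ 0` the values along the orbit are powers of some `w ≠ 1` on the unit circle, whose
geometric sums stay bounded. -/
theorem tendsto_orbitAverage_mFourier {θ : d → ℝ}
    (hθ : ∀ m : d → ℤ, m ≠ 0 → ∀ z : ℤ, ∑ i, m i * θ i ≠ z) (m : d → ℤ) :
    Tendsto (fun N => orbitAverage θ N (UnitAddTorus.mFourier m)) atTop
      (𝓝 (∫ x, UnitAddTorus.mFourier m x ∂(torusMeasure d))) := by
  rw [integral_mFourier]
  split_ifs with h
  · subst h
    refine tendsto_const_nhds.congr' ?_
    filter_upwards [eventually_gt_atTop 0] with N hN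
    rw [orbitAverage]
    simp only [UnitAddTorus.mFourier_zero, ContinuousMap.one_apply, Finset.sum_const, Nat.card_Icc,
      Nat.add_sub_cancel, nsmul_eq_mul, mul_one]
    rw [div_self (by exact_mod_cast hN.ne')]
  · set w : ℂ := Complex.exp (2 * Real.pi * Complex.I * ((∑ i, m i * θ i : ℝ) : ℂ)) with hw
    have hw1 : w ≠ 1 := by
      intro h1
      obtain ⟨z, hz⟩ := Complex.exp_eq_one_iff.mp (hw ▸ h1)
      refine hθ m h z ?_
      have h2 : (2 * Real.pi * Complex.I : ℂ) ≠ 0 := Complex.two_pi_I_ne_zero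
      rw [mul_comm] at hz
      exact_mod_cast mul_right_cancel₀ h2 hz
    have hnorm : ‖w‖ = 1 := by
      rw [hw, mul_assoc, mul_comm Complex.I, ← mul_assoc]
      exact_mod_cast Complex.norm_exp_ofReal_mul_I (2 * Real.pi * ∑ i, m i * θ i)
    have horb : ∀ n : ℕ, UnitAddTorus.mFourier m (orbit θ n) = w ^ n := by
      intro n
      have : UnitAddTorus.mFourier m (orbit θ n) = ∏ i, fourier (m i) (orbit θ n i) := rfl
      rw [this, hw, ← Complex.exp_nat_mul]
      simp only [orbit, fourier_coe_apply]
      rw [← Complex.exp_sum]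
      congr 1
      push_cast
      rw [Finset.mul_sum, Finset.mul_sum]
      refine Finset.sum_congr rfl fun i _ => ?_
      simp only [div_one]
      ring
    have hbound : ∀ N : ℕ, ‖∑ n ∈ Finset.Icc 1 N, w ^ n‖ ≤ 2 / ‖w - 1‖ := by
      intro N
      have h1 : (∑ n ∈ Finset.Icc 1 N, w ^ n) * (w - 1) = w * (w ^ N - 1) := by
        induction N with
        | zero => simp
        | succ N ih =>
          rw [Finset.sum_Icc_succ_top (by omega), add_mul, ih]
          ring
      rw [le_div_iff₀ (norm_pos_iff.mpr (sub_ne_zero.mpr hw1)), ← norm_mul, h1, norm_mul, hnorm,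
        one_mul]
      refine (norm_sub_le _ _).trans ?_
      rw [norm_pow, hnorm]
      norm_num
    refine squeeze_zero_norm (a := fun N : ℕ => (2 / ‖w - 1‖) / N) (fun N => ?_)
      (tendsto_const_div_atTop_nhds_zero_nat _)
    rw [orbitAverage, norm_div, RCLike.norm_natCast]
    simp only [horb]
    gcongr
    exact hbound N

/-- Weyl's theorem: the averages of a continuous function along a linear orbit whose coordinates
are, together with `1`, linearly independent over the integers converge to its integral. -/
theorem tendsto_orbitAverage {θ : d → ℝ}
    (hθ : ∀ m : d → ℤ, m ≠ 0 → ∀ z : ℤ, ∑ i, m i * θ i ≠ z) (f : C(UnitAddTorus d, ℂ)) :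
    Tendsto (fun N => orbitAverage θ N f) atTop (𝓝 (∫ x, f x ∂(torusMeasure d))) := by
  have hint : ∀ g : C(UnitAddTorus d, ℂ), Integrable g (torusMeasure d) := fun g =>
    g.continuous.integrable_of_hasCompactSupport (HasCompactSupport.of_compactSpace g)
  have hspan : ∀ g ∈ Submodule.span ℂ (Set.range (UnitAddTorus.mFourier (d := d))),
      Tendsto (fun N => orbitAverage θ N g) atTop (𝓝 (∫ x, g x ∂(torusMeasure d))) := by
    intro g hg
    induction hg using Submodule.span_induction with
    | mem g hg =>
      obtain ⟨m, rfl⟩ := hg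
      exact tendsto_orbitAverage_mFourier hθ m
    | zero => simp [orbitAverage]
    | add g h _ _ hg hh =>
      simp only [ContinuousMap.add_apply]
      rw [integral_add (hint g) (hint h)]
      refine (hg.add hh).congr fun N => ?_
      simp [orbitAverage, Finset.sum_add_distrib, add_div]
    | smul a g _ hg =>
      simp only [ContinuousMap.smul_apply, smul_eq_mul]
      rw [integral_const_mul]
      refine (hg.const_mul a).congr fun N => ?_
      rw [orbitAverage, orbitAverage, ← mul_div_assoc, Finset.mul_sum]
      rfl
  have hf : f ∈ closure (Submodule.span ℂ (Set.range (UnitAddTorus.mFourier (d := d))) :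
      Set C(UnitAddTorus d, ℂ)) := by
    rw [← Submodule.topologicalClosure_coe, UnitAddTorus.span_mFourier_closure_eq_top]
    trivial
  rw [Metric.tendsto_atTop]
  intro ε hε
  obtain ⟨g, hg, hfg⟩ := Metric.mem_closure_iff.mp hf (ε / 3) (by positivity)
  rw [dist_eq_norm] at hfg
  obtain ⟨N₀, hN₀⟩ := Metric.tendsto_atTop.mp (hspan g hg) (ε / 3) (by positivity)
  refine ⟨N₀, fun N hN => ?_⟩
  have h1 := norm_orbitAverage_sub_le θ N f g
  have h2 : ‖∫ x, g x ∂(torusMeasure d) - ∫ x, f x ∂(torusMeasure d)‖ ≤ ‖f - g‖ := by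
    rw [← integral_sub (hint g) (hint f)]
    refine (norm_integral_le_of_norm_le_const (C := ‖f - g‖)
      (.of_forall fun x => ?_)).trans (by simp)
    rw [norm_sub_rev]
    exact (f - g).norm_coe_le_norm x
  have h3 := hN₀ N hN
  rw [dist_eq_norm] at h3 ⊢
  calc _ = ‖(orbitAverage θ N f - orbitAverage θ N g) +
        (orbitAverage θ N g - ∫ x, g x ∂(torusMeasure d)) +
        (∫ x, g x ∂(torusMeasure d) - ∫ x, f x ∂(torusMeasure d))‖ := by congr 1; ring
    _ ≤ _ := norm_add₃_le
    _ < ε := by linarith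

open Classical in
/-- The frequency of visits of an equidistributed orbit to an open set is asymptotically at least
the measure of the set. -/
theorem eventually_le_card_orbit_mem {θ : d → ℝ}
    (hθ : ∀ m : d → ℤ, m ≠ 0 → ∀ z : ℤ, ∑ i, m i * θ i ≠ z) {U : Set (UnitAddTorus d)}
    (hU : IsOpen U) {c : ℝ} (hc : c < (torusMeasure d).real U) :
    ∀ᶠ N : ℕ in atTop, c ≤ (((Finset.Icc 1 N).filter fun n => orbit θ n ∈ U).card : ℝ) / N := by
  -- Inner regularity gives a compact `K` still of measure above `c`; a Urysohn function between the
  -- indicators of `K` and `U` then bounds the visits from below.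
  obtain ⟨K, hKU, hK, hcK⟩ : ∃ K ⊆ U, IsCompact K ∧ c < (torusMeasure d).real K := by
    rcases lt_or_ge c 0 with h0 | h0
    · exact ⟨∅, Set.empty_subset _, isCompact_empty, by simpa using h0⟩
    · have : ENNReal.ofReal c < torusMeasure d U := by
        rw [← ofReal_measureReal]
        exact (ENNReal.ofReal_lt_ofReal_iff_of_nonneg h0).mpr hc
      have hreg : (torusMeasure d).Regular := by unfold torusMeasure; infer_instance
      obtain ⟨K, hKU, hK, hlt⟩ := hU.exists_lt_isCompact this
      refine ⟨K, hKU, hK, ?_⟩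
      rw [← ofReal_measureReal] at hlt
      exact (ENNReal.ofReal_lt_ofReal_iff_of_nonneg h0).mp hlt
  obtain ⟨f, hf1, hf0, -, hf⟩ := exists_continuous_one_zero_of_isCompact hK hU.isClosed_compl
    (Set.disjoint_left.mpr fun x hx hx' => hx' (hKU hx))
  let g : C(UnitAddTorus d, ℂ) := ⟨fun x => (f x : ℂ), by fun_prop⟩
  have hlim := (Complex.continuous_re.tendsto _).comp (tendsto_orbitAverage hθ g)
  have hint : Integrable f (torusMeasure d) :=
    f.continuous.integrable_of_hasCompactSupport (HasCompactSupport.of_compactSpace f)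
  have hgint : (∫ x, g x ∂(torusMeasure d)).re = ∫ x, f x ∂(torusMeasure d) := by
    have : ∫ x, g x ∂(torusMeasure d) = ((∫ x, f x ∂(torusMeasure d) : ℝ) : ℂ) := integral_ofReal
    rw [this, Complex.ofReal_re]
  have hle : (torusMeasure d).real K ≤ ∫ x, f x ∂(torusMeasure d) := by
    rw [← integral_indicator_one hK.measurableSet]
    refine integral_mono ((integrable_const (1 : ℝ)).indicator hK.measurableSet) hint fun x => ?_
    by_cases hx : x ∈ K
    · rw [Set.indicator_of_mem hx, hf1 hx]
    · rw [Set.indicator_of_notMem hx]; exact (hf x).1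
  rw [hgint] at hlim
  filter_upwards [hlim.eventually (lt_mem_nhds (hcK.trans_le hle))] with N hN
  refine hN.le.trans ?_
  have : (orbitAverage θ N g).re = (∑ n ∈ Finset.Icc 1 N, f (orbit θ n)) / N := by
    have : orbitAverage θ N g = (((∑ n ∈ Finset.Icc 1 N, f (orbit θ n)) / N : ℝ) : ℂ) := by
      simp [orbitAverage, g]
    rw [this, Complex.ofReal_re]
  simp only [Function.comp_apply, this]
  gcongr
  rw [Finset.card_filter]
  push_cast
  refine Finset.sum_le_sum fun n _ => ?_
  split_ifs with h
  · exact (hf _).2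
  · exact (hf0 h).le

/-- The measure of an open arc. -/
theorem haarAddCircle_coe_image_Ioo {a b : ℝ} (hab : a ≤ b) (hb : b ≤ a + 1) :
    (haarAddCircle : Measure UnitAddCircle).real ((↑) '' Set.Ioo a b) = b - a := by
  have hvol : (haarAddCircle : Measure UnitAddCircle) = volume := by
    rw [AddCircle.volume_eq_smul_haarAddCircle]; simp
  have hopen : IsOpen (((↑) : ℝ → UnitAddCircle) '' Set.Ioo a b) :=
    QuotientAddGroup.isOpenMap_coe _ isOpen_Ioo
  have hset : ((↑) : ℝ → UnitAddCircle) ⁻¹' ((↑) '' Set.Ioo a b) ∩ Set.Ioc a (a + 1) =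
      Set.Ioo a b := by
    ext x
    constructor
    · rintro ⟨⟨y, hy, hyx⟩, hx⟩
      have h1 : y ∈ Set.Ioc a (a + 1) := ⟨hy.1, hy.2.le.trans hb⟩
      rw [← (AddCircle.coe_eq_coe_iff_of_mem_Ioc (p := (1 : ℝ)) h1 hx).mp hyx]
      exact hy
    · exact fun hx => ⟨⟨x, hx, rfl⟩, hx.1, hx.2.le.trans hb⟩
  rw [hvol, measureReal_def, AddCircle.add_projection_respects_measure 1 a hopen.measurableSet]
  erw [hset]
  rw [Real.volume_Ioo, ENNReal.toReal_ofReal (by linarith)]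

end Weyl

/-! ### Lower densities -/

/-- The lower asymptotic density of `X` is at least `d`. -/
def LowerDensityGE (X : Set ℕ) (d : ℝ) : Prop :=
  ∀ c < d, ∀ᶠ x : ℝ in atTop, c ≤ proportion X x

theorem finite_inter_le (X : Set ℕ) (x : ℝ) : {n : ℕ | n ∈ X ∧ (n : ℝ) ≤ x}.Finite :=
  (Set.finite_Iic ⌊x⌋₊).subset fun _ hn => Nat.le_floor hn.2

theorem proportion_nonneg (X : Set ℕ) {x : ℝ} (hx : 0 ≤ x) : 0 ≤ proportion X x :=
  div_nonneg (Nat.cast_nonneg _) hx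

theorem proportion_mono {X Y : Set ℕ} (h : X ⊆ Y) {x : ℝ} (hx : 0 ≤ x) :
    proportion X x ≤ proportion Y x := by
  unfold proportion
  gcongr
  exact finite_inter_le Y x

theorem proportion_union_le (X Y : Set ℕ) {x : ℝ} (hx : 0 ≤ x) :
    proportion (X ∪ Y) x ≤ proportion X x + proportion Y x := by
  unfold proportion
  rw [← add_div]
  gcongr
  have h : {n : ℕ | n ∈ X ∪ Y ∧ (n : ℝ) ≤ x} =
      {n : ℕ | n ∈ X ∧ (n : ℝ) ≤ x} ∪ {n : ℕ | n ∈ Y ∧ (n : ℝ) ≤ x} := by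
    ext n; simp only [Set.mem_union, Set.mem_ofPred_eq]; tauto
  rw [h]
  exact_mod_cast Set.ncard_union_le _ _

theorem proportion_union {X Y : Set ℕ} (hXY : Disjoint X Y) (x : ℝ) :
    proportion (X ∪ Y) x = proportion X x + proportion Y x := by
  unfold proportion
  rw [← add_div]
  have h : {n : ℕ | n ∈ X ∪ Y ∧ (n : ℝ) ≤ x} =
      {n : ℕ | n ∈ X ∧ (n : ℝ) ≤ x} ∪ {n : ℕ | n ∈ Y ∧ (n : ℝ) ≤ x} := by
    ext n; simp only [Set.mem_union, Set.mem_ofPred_eq]; tauto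
  rw [h, Set.ncard_union_eq _ (finite_inter_le X x) (finite_inter_le Y x)]
  · push_cast; rfl
  · exact Set.disjoint_left.mpr fun n hn hn' => Set.disjoint_left.mp hXY hn.1 hn'.1

theorem proportion_le_one {X : Set ℕ} (hX : ∀ n ∈ X, 1 ≤ n) {x : ℝ} (hx : 0 ≤ x) :
    proportion X x ≤ 1 := by
  refine div_le_one_of_le₀ ?_ hx
  have h : {n : ℕ | n ∈ X ∧ (n : ℝ) ≤ x} ⊆ (Finset.Icc 1 ⌊x⌋₊ : Finset ℕ) := fun n hn =>
    Finset.mem_coe.mpr (Finset.mem_Icc.mpr ⟨hX n hn.1, Nat.le_floor hn.2⟩)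
  have h1 := Set.ncard_le_ncard h (Finset.finite_toSet _)
  rw [Set.ncard_coe_finset, Nat.card_Icc, Nat.add_sub_cancel] at h1
  exact (Nat.cast_le.mpr h1).trans (Nat.floor_le hx)

theorem LowerDensityGE.mono {X Y : Set ℕ} {d e : ℝ} (h : LowerDensityGE X d) (hXY : X ⊆ Y)
    (hed : e ≤ d) : LowerDensityGE Y e := fun c hc => by
  filter_upwards [h c (hc.trans_le hed), eventually_ge_atTop 0] with x h1 h2
  exact h1.trans (proportion_mono hXY h2)

theorem lowerDensityGE_empty : LowerDensityGE ∅ 0 := fun c hc => by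
  filter_upwards [eventually_ge_atTop 0] with x hx
  exact hc.le.trans (proportion_nonneg _ hx)

theorem LowerDensityGE.union {X Y : Set ℕ} {d e : ℝ} (hX : LowerDensityGE X d)
    (hY : LowerDensityGE Y e) (hXY : Disjoint X Y) : LowerDensityGE (X ∪ Y) (d + e) := by
  intro c hc
  filter_upwards [hX (d - (d + e - c) / 2) (by linarith),
    hY (e - (d + e - c) / 2) (by linarith)] with x h1 h2
  rw [proportion_union hXY]
  linarith

theorem lowerDensityGE_biUnion {P : Type*} {B : P → Set ℕ}
    (hB : Pairwise (Function.onFun Disjoint B)) {d : P → ℝ} (hd : ∀ p, LowerDensityGE (B p) (d p)) (s : Finset P) :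
    LowerDensityGE (⋃ p ∈ s, B p) (∑ p ∈ s, d p) := by
  classical
  induction s using Finset.induction_on with
  | empty => simpa using lowerDensityGE_empty
  | insert p s hp ih =>
    rw [Finset.sum_insert hp, Finset.set_biUnion_insert]
    refine (hd p).union ih ?_
    simp only [Set.disjoint_iUnion_right]
    exact fun q hq => hB fun h => hp (h ▸ hq)

/-- Density is not countably additive, but a finite subunion already comes arbitrarily close to the
required lower bound. -/
theorem lowerDensityGE_iUnion {P : Type*} {B : P → Set ℕ}
    (hB : Pairwise (Function.onFun Disjoint B)) {d : P → ℝ}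
    (hd : ∀ p, LowerDensityGE (B p) (d p)) (hsum : Summable d) (Q : Set P) :
    LowerDensityGE (⋃ p ∈ Q, B p) (∑' p : Q, d p) := by
  intro c hc
  obtain ⟨s, hs⟩ := ((hsum.subtype Q).hasSum.eventually (lt_mem_nhds hc)).exists
  have h := lowerDensityGE_biUnion (B := fun p : Q => B p) (d := fun p : Q => d p)
    (fun p q hpq => hB fun h => hpq (Subtype.ext h)) (fun p => hd p) s
  refine h.mono ?_ le_rfl c hs
  exact Set.iUnion₂_subset fun p _ => Set.subset_biUnion_of_mem (u := B) p.2

/-- If disjoint sets of positive integers have lower densities at least `d p`, where the `d p` add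
up to `1`, then all their unions have the density that one expects. -/
theorem hasDensity_biUnion {P : Type*} {B : P → Set ℕ} (hB : Pairwise (Function.onFun Disjoint B))
    (hpos : ∀ p, ∀ n ∈ B p, 1 ≤ n) {d : P → ℝ} (hd : ∀ p, LowerDensityGE (B p) (d p))
    (hsum : HasSum d 1) (Q : Set P) : HasDensity (⋃ p ∈ Q, B p) (∑' p : Q, d p) := by
  have hdisj : Disjoint (⋃ p ∈ Q, B p) (⋃ p ∈ Qᶜ, B p) := by
    simp only [Set.disjoint_iUnion_left, Set.disjoint_iUnion_right]
    exact fun p hp q hq => hB fun h => hp (h ▸ hq)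
  have h1 : ∑' p : Q, d p + ∑' p : ↥Qᶜ, d p = 1 :=
    (hsum.summable.tsum_subtype_add_tsum_subtype_compl Q).trans hsum.tsum_eq
  refine tendsto_order.mpr ⟨fun c hc => ?_, fun c hc => ?_⟩
  · obtain ⟨c', hc', hc''⟩ := exists_between hc
    filter_upwards [lowerDensityGE_iUnion hB hd hsum.summable Q c' hc''] with x hx
    exact hc'.trans_le hx
  -- The upper bound for `Q` is the lower bound for `Qᶜ`, as both proportions together are at most
  -- 1.
  · obtain ⟨c', hc', hc''⟩ := exists_between hc
    filter_upwards [lowerDensityGE_iUnion hB hd hsum.summable Qᶜ (1 - c') (by linarith),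
      eventually_ge_atTop 0] with x hx hx0
    have h2 := proportion_le_one (X := (⋃ p ∈ Q, B p) ∪ ⋃ p ∈ Qᶜ, B p) (fun n hn => by
      simp only [Set.mem_union, Set.mem_iUnion] at hn
      rcases hn with ⟨p, -, hn⟩ | ⟨p, -, hn⟩ <;> exact hpos p n hn) hx0
    rw [proportion_union hdisj] at h2
    linarith

/-! ### Multiples of real numbers in short intervals -/

/-- Some multiple of `l` lies in the open interval `(s, t)`. -/
def Hit (l s t : ℝ) : Prop := ∃ a : ℕ, s < a * l ∧ a * l < t

/-- If `a * l` lies in `(n, n + 2)`, then `n` is `⌈a * l⌉ - 1` or `⌈a * l⌉ - 2`, and `a ≤ (x + 2) /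
l`. -/
theorem ncard_hit_le {l : ℝ} (hl : 0 < l) {x : ℝ} (hx : 0 ≤ x) :
    ({n : ℕ | Hit l n (n + 2) ∧ (n : ℝ) ≤ x}.ncard : ℝ) ≤ 2 * (x + 2) * (1 / l) := by
  classical
  set M := ⌊(x + 2) / l⌋₊
  let T : Finset ℕ := (Finset.Icc 1 M ×ˢ Finset.range 2).image
    fun p => ⌈(p.1 : ℝ) * l⌉₊ - 1 - p.2
  have hsub : {n : ℕ | Hit l n (n + 2) ∧ (n : ℝ) ≤ x} ⊆ T := by
    rintro n ⟨⟨a, h1, h2⟩, hn⟩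
    have ha : 1 ≤ a := by
      rcases Nat.eq_zero_or_pos a with rfl | h
      · simp only [Nat.cast_zero, zero_mul] at h1
        exact absurd h1 (not_lt.mpr (Nat.cast_nonneg n))
      · exact h
    have haM : a ≤ M := Nat.le_floor ((le_div_iff₀ hl).mpr (by linarith))
    have h3 : n < ⌈(a : ℝ) * l⌉₊ := Nat.lt_ceil.mpr h1
    have h4 : ⌈(a : ℝ) * l⌉₊ ≤ n + 2 := Nat.ceil_le.mpr (by push_cast; exact h2.le)
    refine Finset.mem_coe.mpr (Finset.mem_image.mpr ⟨(a, ⌈(a : ℝ) * l⌉₊ - 1 - n), ?_, ?_⟩)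
    · simp only [Finset.mem_product, Finset.mem_Icc, Finset.mem_range]
      omega
    · simp only
      omega
  have h1 := Set.ncard_le_ncard hsub (Finset.finite_toSet _)
  rw [Set.ncard_coe_finset] at h1
  have h2 : T.card ≤ M * 2 := by
    refine Finset.card_image_le.trans ?_
    rw [Finset.card_product]
    simp
  have h3 : (M : ℝ) ≤ (x + 2) / l := Nat.floor_le (div_nonneg (by linarith) hl.le)
  have h4 : ({n : ℕ | Hit l n (n + 2) ∧ (n : ℝ) ≤ x}.ncard : ℝ) ≤ M * 2 := by
    exact_mod_cast h1.trans h2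
  calc _ ≤ (M : ℝ) * 2 := h4
    _ ≤ (x + 2) / l * 2 := by gcongr
    _ = _ := by ring

theorem proportion_hit_le {ι : Type*} {L : ι → ℝ} (hL : ∀ i, 0 < L i)
    (hsum : Summable fun i => 1 / L i) {x : ℝ} (hx : 1 ≤ x) :
    proportion {n | ∃ i, Hit (L i) n (n + 2)} x ≤ 6 * ∑' i, 1 / L i := by
  classical
  set X := {n : ℕ | n ∈ {n : ℕ | ∃ i, Hit (L i) n (n + 2)} ∧ (n : ℝ) ≤ x} with hX
  have hfin : X.Finite := finite_inter_le _ x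
  have hS : 0 ≤ ∑' i, 1 / L i := tsum_nonneg fun j => (one_div_pos.mpr (hL j)).le
  have hcard : (X.ncard : ℝ) ≤ 2 * (x + 2) * ∑' i, 1 / L i := by
    rcases X.eq_empty_or_nonempty with h | ⟨n, ⟨i₀, -⟩, -⟩
    · rw [h, Set.ncard_empty, Nat.cast_zero]
      positivity
    have : Nonempty ι := ⟨i₀⟩
    -- One chosen index for each of the finitely many `n` reduces the union bound to finitely many
    -- indices.
    choose! i hi using fun n (hn : n ∈ X) => hn.1
    set T := hfin.toFinset.image i
    have hsub : X ⊆ ⋃ j ∈ T, {n : ℕ | Hit (L j) n (n + 2) ∧ (n : ℝ) ≤ x} := fun n hn =>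
      Set.mem_biUnion (Finset.mem_image_of_mem i (hfin.mem_toFinset.mpr hn)) ⟨hi n hn, hn.2⟩
    have h1 : (X.ncard : ℝ) ≤ ∑ j ∈ T, ({n : ℕ | Hit (L j) n (n + 2) ∧ (n : ℝ) ≤ x}.ncard : ℝ) := by
      have h2 := Set.ncard_le_ncard hsub
        (T.finite_toSet.biUnion fun j _ => finite_inter_le {n : ℕ | Hit (L j) n (n + 2)} x)
      have h3 := Finset.set_ncard_biUnion_le T
        fun j => {n : ℕ | Hit (L j) n (n + 2) ∧ (n : ℝ) ≤ x}
      exact_mod_cast h2.trans h3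
    refine h1.trans ((Finset.sum_le_sum fun j _ => ncard_hit_le (hL j) (by linarith)).trans ?_)
    rw [← Finset.mul_sum]
    gcongr
    exact hsum.sum_le_tsum T fun j _ => (one_div_pos.mpr (hL j)).le
  rw [proportion, div_le_iff₀ (by linarith)]
  refine hcard.trans ?_
  -- The constant 6 comes from `2 * (x + 2) ≤ 6 * x` for `x ≥ 1`.
  nlinarith

/-- The `n` for which exactly the `L i`, `i ∈ I`, have a multiple in `(n, n + 1)`, and exactly the
`L i`, `i ∈ J`, have a multiple in `(n + 1, n + 2)`. -/
def HitPattern {ι : Type*} (L : ι → ℝ) (I J : Finset ι) : Set ℕ :=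
  {n | 1 ≤ n ∧ ∀ i, (Hit (L i) n (n + 1) ↔ i ∈ I) ∧ (Hit (L i) (n + 1) (n + 2) ↔ i ∈ J)}

theorem Hit.mono {l s t s' t' : ℝ} (h : Hit l s t) (hs : s' ≤ s) (ht : t ≤ t') : Hit l s' t' := by
  obtain ⟨a, h1, h2⟩ := h
  exact ⟨a, hs.trans_lt h1, h2.trans_le ht⟩

/-- An interval of length at most `l` contains at most one multiple of `l`. -/
theorem eq_of_mul_mem_Ioo {l s t : ℝ} (ht : t ≤ s + l) {a b : ℕ} (ha : s < a * l)
    (ha' : a * l < t) (hb : s < b * l) (hb' : b * l < t) : a = b := by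
  have hl : 0 < l := by linarith
  have h1 : ((a : ℝ) - b) * l < 1 * l := by linarith
  have h2 : ((b : ℝ) - a) * l < 1 * l := by linarith
  have h3 : (a : ℝ) < b + 1 := by linarith [lt_of_mul_lt_mul_right h1 hl.le]
  have h4 : (b : ℝ) < a + 1 := by linarith [lt_of_mul_lt_mul_right h2 hl.le]
  have h5 : a < b + 1 := by exact_mod_cast h3
  have h6 : b < a + 1 := by exact_mod_cast h4
  omega

theorem not_hit_and_hit {l : ℝ} (hl : 2 ≤ l) {s : ℝ} (h1 : Hit l s (s + 1))
    (h2 : Hit l (s + 1) (s + 2)) : False := by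
  obtain ⟨a, ha, ha'⟩ := h1
  obtain ⟨b, hb, hb'⟩ := h2
  have := eq_of_mul_mem_Ioo (l := l) (s := s) (t := s + 2) (by linarith) ha (by linarith)
    (by linarith) hb'
  subst this
  linarith

/-- A multiple of `l` lies in `(n + s, n + t)` as soon as `n / l` lies in an arc. -/
theorem hit_of_coe_mem {l : ℝ} (hl : 0 < l) {s t : ℝ} (hs : 0 ≤ s) {n : ℕ}
    (h : (((n : ℝ) * (1 / l) : ℝ) : UnitAddCircle) ∈
      ((↑) : ℝ → UnitAddCircle) '' Set.Ioo (-t / l) (-s / l)) : Hit l (n + s) (n + t) := by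
  obtain ⟨y, ⟨hy1, hy2⟩, hy⟩ := h
  obtain ⟨c, hc⟩ := (AddCircle.coe_eq_zero_iff (1 : ℝ)).mp (sub_eq_zero.mpr hy.symm)
  rw [zsmul_eq_mul, mul_one] at hc
  rw [div_lt_iff₀ hl] at hy1
  rw [lt_div_iff₀ hl] at hy2
  have hcl : (c : ℝ) * l = n - y * l := by
    rw [hc]
    field_simp
  -- The multiple sought is `c * l = n - y * l`; it exceeds `n + s ≥ 0`, so `c` is a natural number.
  have hc0 : 0 < c := by
    have h1 : 0 < (c : ℝ) * l := by
      have : (0 : ℝ) ≤ n := Nat.cast_nonneg n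
      linarith
    exact_mod_cast pos_of_mul_pos_left h1 hl.le
  have hct : ((c.toNat : ℕ) : ℝ) = c := by exact_mod_cast Int.toNat_of_nonneg hc0.le
  exact ⟨c.toNat, by rw [hct]; linarith, by rw [hct]; linarith⟩

/-- Here `n / l` has integral part `c` with `c * l < n` and `n + 2 < (c + 1) * l`: two consecutive
multiples enclose the interval. -/
theorem not_hit_of_coe_mem {l : ℝ} (hl : 0 < l) {n : ℕ}
    (h : (((n : ℝ) * (1 / l) : ℝ) : UnitAddCircle) ∈
      ((↑) : ℝ → UnitAddCircle) '' Set.Ioo 0 (1 - 2 / l)) : ¬ Hit l n (n + 2) := by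
  obtain ⟨y, ⟨hy1, hy2⟩, hy⟩ := h
  obtain ⟨c, hc⟩ := (AddCircle.coe_eq_zero_iff (1 : ℝ)).mp (sub_eq_zero.mpr hy.symm)
  rw [zsmul_eq_mul, mul_one] at hc
  have hcl : (c : ℝ) * l = n - y * l := by
    rw [hc]
    field_simp
  have hy3 : y * l < l - 2 := by
    have := mul_lt_mul_of_pos_right hy2 hl
    rwa [sub_mul, one_mul, div_mul_cancel₀ _ hl.ne'] at this
  have hy4 := mul_pos hy1 hl
  rintro ⟨a, h1, h2⟩
  have h3 : (c : ℝ) * l < (a : ℤ) * l := by push_cast; linarith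
  have h4 : ((a : ℤ) : ℝ) * l < ((c + 1 : ℤ) : ℝ) * l := by push_cast; linarith
  have h5 : c < a := by exact_mod_cast lt_of_mul_lt_mul_right h3 hl.le
  have h6 : (a : ℤ) < c + 1 := by exact_mod_cast lt_of_mul_lt_mul_right h4 hl.le
  omega

theorem lowerDensityGE_orbit {d : Type*} [Fintype d] {θ : d → ℝ}
    (hθ : ∀ m : d → ℤ, m ≠ 0 → ∀ z : ℤ, ∑ i, m i * θ i ≠ z) {U : Set (UnitAddTorus d)}
    (hU : IsOpen U) :
    LowerDensityGE {n : ℕ | 1 ≤ n ∧ orbit θ n ∈ U} ((torusMeasure d).real U) := by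
  classical
  intro c hc
  rcases lt_or_ge c 0 with h0 | h0
  · filter_upwards [eventually_ge_atTop 0] with x hx
    exact h0.le.trans (proportion_nonneg _ hx)
  obtain ⟨c', hc', hc''⟩ := exists_between hc
  have h1 := tendsto_nat_floor_atTop (α := ℝ) |>.eventually
    (eventually_le_card_orbit_mem hθ hU hc'')
  have h2 : Tendsto (fun x : ℝ => c' * ((⌊x⌋₊ : ℝ) / x)) atTop (𝓝 (c' * 1)) :=
    (tendsto_nat_floor_div_atTop (R := ℝ)).const_mul c'
  rw [mul_one] at h2
  filter_upwards [h1, h2.eventually (lt_mem_nhds hc'), eventually_ge_atTop 1] with x hx1 hx2 hx3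
  have hN : (0 : ℝ) < (⌊x⌋₊ : ℝ) := by exact_mod_cast Nat.floor_pos.mpr hx3
  have hset : {n : ℕ | n ∈ {n : ℕ | 1 ≤ n ∧ orbit θ n ∈ U} ∧ (n : ℝ) ≤ x} =
      ((Finset.Icc 1 ⌊x⌋₊).filter fun n => orbit θ n ∈ U : Finset ℕ) := by
    ext n
    simp only [Set.mem_ofPred_eq, Finset.coe_filter, Finset.mem_Icc,
      Nat.le_floor_iff (zero_le_one.trans hx3)]
    tauto
  rw [proportion, hset, Set.ncard_coe_finset]
  refine hx2.le.trans ?_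
  rw [le_div_iff₀ hN] at hx1
  rw [← mul_div_assoc]
  gcongr

open Classical in
/-- The lower density of a set `HitPattern L I J` is at least the product expected from
independence. -/
theorem lowerDensityGE_hitPattern {ι : Type*} {L : ι → ℝ} (hL : ∀ i, 2 < L i)
    (hsum : Summable fun i => 1 / L i)
    (hli : LinearIndependent ℚ (fun o : Option ι => o.elim (1 : ℝ) fun i => 1 / L i))
    {I J : Finset ι} (hIJ : Disjoint I J) {d : ℝ}
    (hd : HasProd (fun i => if i ∈ I ∪ J then 1 / L i else 1 - 2 / L i) d) :
    LowerDensityGE (HitPattern L I J) d := by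
  intro c hc
  have hL0 : ∀ i, 0 < L i := fun i => two_pos.trans (hL i)
  set δ := (d - c) / 4 with hδ
  have hδ0 : 0 < δ := by rw [hδ]; linarith
  have htail := tendsto_tsum_compl_atTop_zero fun i => 1 / L i
  have hprod := hd.eventually (lt_mem_nhds (show d - δ < d by linarith))
  rw [SummationFilter.unconditional_filter] at hprod
  -- Stopping at `F` costs `δ` in the product, equidistribution another `δ`, and the indices outside
  -- `F` at most `6 * (δ / 6)`, within the allowance `d - c = 4 * δ`.
  obtain ⟨F, ⟨hFprod, hFtail⟩, hF⟩ := (((hprod.and (htail.eventually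
    (gt_mem_nhds (show (0 : ℝ) < δ / 6 by positivity))))).and (eventually_ge_atTop (I ∪ J))).exists
  -- The arc of `n / L i` modulo 1 for a multiple in `(n, n + 1)`, in `(n + 1, n + 2)`, or in
  -- neither. The form `-0 / L i` matches `hit_of_coe_mem` at `s = 0`.
  let lo : ι → ℝ := fun i => if i ∈ I then -1 / L i else if i ∈ J then -2 / L i else 0
  let hi : ι → ℝ := fun i => if i ∈ I then -0 / L i else if i ∈ J then -1 / L i else 1 - 2 / L i
  have harc : ∀ i, lo i ≤ hi i ∧ hi i ≤ lo i + 1 ∧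
      hi i - lo i = if i ∈ I ∪ J then 1 / L i else 1 - 2 / L i := by
    intro i
    have h1 : 0 < 1 / L i := one_div_pos.mpr (hL0 i)
    have h2 : 2 / L i < 1 := (div_lt_one (hL0 i)).mpr (hL i)
    have h3 : 2 / L i = 2 * (1 / L i) := by ring
    simp only [lo, hi, Finset.mem_union]
    by_cases hI : i ∈ I
    · rw [if_pos hI, if_pos hI, if_pos (.inl hI)]
      have : -1 / L i = -(1 / L i) := by ring
      rw [this, neg_zero, zero_div]
      refine ⟨by linarith, by linarith, by ring⟩
    · by_cases hJ : i ∈ J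
      · rw [if_neg hI, if_neg hI, if_pos hJ, if_pos hJ, if_pos (.inr hJ)]
        refine ⟨?_, ?_, by ring⟩
        · have : -1 / L i - -2 / L i = 1 / L i := by ring
          linarith
        · have : -1 / L i - -2 / L i = 1 / L i := by ring
          linarith
      · rw [if_neg hI, if_neg hI, if_neg hJ, if_neg hJ, if_neg (by tauto)]
        refine ⟨by linarith, by linarith, by ring⟩
  let U : Set (UnitAddTorus F) :=
    Set.univ.pi fun i : F => ((↑) : ℝ → UnitAddCircle) '' Set.Ioo (lo i) (hi i)
  have hU : IsOpen U :=
    isOpen_set_pi Set.finite_univ fun i _ => QuotientAddGroup.isOpenMap_coe _ isOpen_Ioo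
  have hmeas : (torusMeasure F).real U = ∏ i ∈ F, if i ∈ I ∪ J then 1 / L i else 1 - 2 / L i := by
    rw [MeasureTheory.measureReal_def, torusMeasure, MeasureTheory.Measure.pi_pi,
      ENNReal.toReal_prod, ← Finset.prod_coe_sort F]
    refine Finset.prod_congr rfl fun i _ => ?_
    rw [← (harc i).2.2, ← haarAddCircle_coe_image_Ioo (harc i).1 (harc i).2.1]
    rfl
  have hθ : ∀ m : F → ℤ, m ≠ 0 → ∀ z : ℤ, ∑ i, m i * (1 / L i) ≠ z := by
    intro m hm z hz
    refine hm (funext fun i => ?_)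
    -- An integral value `z` would be a rational relation with coefficient `-z` at `1`.
    let g : Option ι → ℚ := fun o => o.elim (-z : ℚ)
      fun j => if h : j ∈ F then (m ⟨j, h⟩ : ℚ) else 0
    have h1 := linearIndependent_iff'.mp hli F.insertNone g (by
      rw [Finset.sum_insertNone, ← Finset.sum_coe_sort]
      simp only [g, Option.elim_none, Option.elim_some, Finset.coe_mem, dite_true, Rat.smul_def]
      push_cast
      rw [hz]
      ring) (some i) (by simp)
    simpa [g] using h1
  have hlow := lowerDensityGE_orbit hθ hU
  rw [hmeas] at hlow
  have hsub : {n : ℕ | 1 ≤ n ∧ orbit (fun i : F => 1 / L i) n ∈ U} ⊆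
      HitPattern L I J ∪ {n : ℕ | ∃ i : {i // i ∉ F}, Hit (L i) n (n + 2)} := by
    rintro n ⟨hn, hnU⟩
    by_cases hex : ∃ i : {i // i ∉ F}, Hit (L i) n (n + 2)
    · exact .inr hex
    refine .inl ⟨hn, fun i => ?_⟩
    by_cases hiF : i ∈ F
    · have hmem := hnU ⟨i, hiF⟩ trivial
      simp only [orbit, lo, hi] at hmem
      by_cases hI : i ∈ I
      · have hJ : i ∉ J := Finset.disjoint_left.mp hIJ hI
        rw [if_pos hI, if_pos hI] at hmem
        have := hit_of_coe_mem (hL0 i) le_rfl hmem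
        rw [add_zero] at this
        exact ⟨iff_of_true this hI, iff_of_false (fun h => not_hit_and_hit (hL i).le this h) hJ⟩
      · by_cases hJ : i ∈ J
        · rw [if_neg hI, if_neg hI, if_pos hJ, if_pos hJ] at hmem
          have := hit_of_coe_mem (hL0 i) zero_le_one hmem
          exact ⟨iff_of_false (fun h => not_hit_and_hit (hL i).le h this) hI, iff_of_true this hJ⟩
        · rw [if_neg hI, if_neg hI, if_neg hJ, if_neg hJ] at hmem
          have := not_hit_of_coe_mem (hL0 i) hmem
          exact ⟨iff_of_false (fun h => this (h.mono le_rfl (by linarith))) hI,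
            iff_of_false (fun h => this (h.mono (by linarith) le_rfl)) hJ⟩
    · have hIJ' : i ∉ I ∪ J := fun h => hiF (hF h)
      rw [Finset.mem_union, not_or] at hIJ'
      have : ¬ Hit (L i) n (n + 2) := fun h => hex ⟨⟨i, hiF⟩, h⟩
      exact ⟨iff_of_false (fun h => this (h.mono le_rfl (by linarith))) hIJ'.1,
        iff_of_false (fun h => this (h.mono (by linarith) le_rfl)) hIJ'.2⟩
  filter_upwards [hlow (d - 2 * δ) (by linarith), eventually_ge_atTop 1] with x hx hx1
  have h1 := (proportion_mono hsub (zero_le_one.trans hx1)).trans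
    (proportion_union_le _ _ (zero_le_one.trans hx1))
  have h2 := proportion_hit_le (L := fun i : {i // i ∉ F} => L i) (fun i => hL0 i)
    (hsum.subtype _) hx1
  linarith

/-! ### The generating function of the densities -/

section GeneratingFunction

variable {ι : Type*} {L : ι → ℝ}

open Classical in
/-- The expected density of `HitPattern L I J`. -/
noncomputable def patternDensity (L : ι → ℝ) (I J : Finset ι) : ℝ :=
  (∏' i, (1 - 2 / L i)) * ∏ i ∈ I ∪ J, 1 / (L i - 2)

/-- All but finitely many `L i` exceed 4, where `1 / (L i - 2) ≤ 2 / L i`. -/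
theorem summable_one_div_sub_two (hL : ∀ i, 2 < L i) (hsum : Summable fun i => 1 / L i) :
    Summable fun i => 1 / (L i - 2) := by
  refine (hsum.mul_left 2).of_norm_bounded_eventually ?_
  have h := hsum.tendsto_cofinite_zero.eventually (gt_mem_nhds (show (0 : ℝ) < 1 / 4 by norm_num))
  filter_upwards [h] with i hi
  have h2 := hL i
  have h4 : 4 < L i := by
    by_contra hle
    exact absurd (one_div_le_one_div_of_le (by linarith) (not_lt.mp hle)) (not_le.mpr hi)
  have h5 : 0 < L i - 2 := by linarith
  rw [Real.norm_of_nonneg (by positivity), ← mul_div_assoc, div_le_div_iff₀ h5 (by linarith)]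
  linarith

theorem summable_two_div (hsum : Summable fun i => 1 / L i) : Summable fun i => -(2 / L i) := by
  simpa [div_eq_mul_inv] using (hsum.mul_left 2).neg

theorem multipliable_one_sub_two_div (hsum : Summable fun i => 1 / L i) :
    Multipliable fun i => 1 - 2 / L i := by
  simpa [sub_eq_add_neg] using Real.multipliable_one_add_of_summable (summable_two_div hsum)

theorem one_sub_two_div_pos {l : ℝ} (hl : 2 < l) : 0 < 1 - 2 / l :=
  sub_pos.mpr ((div_lt_one (by linarith)).mpr hl)

/-- The logarithms of the factors are summable, so the product is an exponential. -/
theorem tprod_one_sub_two_div_pos (hL : ∀ i, 2 < L i) (hsum : Summable fun i => 1 / L i) :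
    0 < ∏' i, (1 - 2 / L i) := by
  have h := Real.summable_log_one_add_of_summable (summable_two_div hsum)
  simp only [← sub_eq_add_neg] at h
  rw [← Real.rexp_tsum_eq_tprod (fun i => one_sub_two_div_pos (hL i)) h]
  exact Real.exp_pos _

theorem patternDensity_pos (hL : ∀ i, 2 < L i) (hsum : Summable fun i => 1 / L i)
    (I J : Finset ι) : 0 < patternDensity L I J :=
  mul_pos (tprod_one_sub_two_div_pos hL hsum) (Finset.prod_pos fun i _ =>
    one_div_pos.mpr (sub_pos.mpr (hL i)))

-- As `1 / L i = (1 - 2 / L i) * (1 / (L i - 2))`, changing finitely many factors multiplies the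
-- full product by the corresponding `1 / (L i - 2)`.
open Classical in
theorem hasProd_patternDensity (hL : ∀ i, 2 < L i) (hsum : Summable fun i => 1 / L i)
    (I J : Finset ι) :
    HasProd (fun i => if i ∈ I ∪ J then 1 / L i else 1 - 2 / L i) (patternDensity L I J) := by
  have h1 : HasProd (fun i => if i ∈ I ∪ J then 1 / (L i - 2) else 1)
      (∏ i ∈ I ∪ J, 1 / (L i - 2)) := by
    rw [← Finset.prod_congr rfl fun i (hi : i ∈ I ∪ J) => if_pos hi]
    exact hasProd_prod_of_ne_finset_one fun i hi => if_neg hi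
  rw [patternDensity]
  convert (multipliable_one_sub_two_div hsum).hasProd.mul h1 using 2 with i
  have h2 := hL i
  split_ifs
  · have h3 : L i ≠ 0 := by linarith
    have h4 : L i - 2 ≠ 0 := by linarith
    field_simp
  · rw [mul_one]

open Classical in
/-- Expanding a product of sums over pairs of disjoint finite sets. -/
theorem hasSum_disjointPairs {f g : ι → ℂ} (hf : Summable fun i => ‖f i‖)
    (hg : Summable fun i => ‖g i‖) :
    HasSum (fun p : {p : Finset ι × Finset ι // Disjoint p.1 p.2} =>
      (∏ i ∈ p.1.1, f i) * ∏ i ∈ p.1.2, g i) (∏' i, (1 + (f i + g i))) := by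
  have hfg : Summable fun K : Finset ι => ∏ i ∈ K, (f i + g i) :=
    summable_finsetProd_of_summable_norm
      ((hf.add hg).of_nonneg_of_le (fun _ => norm_nonneg _) fun _ => norm_add_le _ _)
  have hnorm : ∀ {h : ι → ℂ}, (Summable fun i => ‖h i‖) →
      Summable fun K : Finset ι => ‖∏ i ∈ K, h i‖ := fun hh => by
    simp only [norm_prod]
    exact summable_finsetProd_of_summable_nonneg (fun _ => norm_nonneg _) hh
  have hsummable := (summable_mul_of_summable_norm (hnorm hf) (hnorm hg)).subtype
    {p : Finset ι × Finset ι | Disjoint p.1 p.2}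
  -- Pairs are grouped by their union `K`; the fibre is the powerset of `K`, over which `∏ i ∈ K, (f
  -- i + g i)` expands.
  let e : (Σ K : Finset ι, {I : Finset ι // I ∈ K.powerset}) ≃
      {p : Finset ι × Finset ι // Disjoint p.1 p.2} :=
    { toFun := fun s => ⟨(s.2.1, s.1 \ s.2.1), Finset.disjoint_sdiff⟩
      invFun := fun p => ⟨p.1.1 ∪ p.1.2, p.1.1, Finset.mem_powerset.mpr Finset.subset_union_left⟩
      left_inv := by
        rintro ⟨K, I, hI⟩
        have h := Finset.union_sdiff_of_subset (Finset.mem_powerset.mp hI)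
        simp only [Sigma.mk.injEq]
        refine ⟨h, ?_⟩
        congr! 1
        simp [h]
      right_inv := by
        rintro ⟨⟨I, J⟩, h⟩
        simp only [Subtype.mk.injEq, Prod.mk.injEq, true_and]
        exact Finset.union_sdiff_cancel_left h }
  rw [tprod_one_add hfg, ← e.hasSum_iff]
  refine HasSum.sigma_of_hasSum hfg.hasSum (fun K => ?_) (e.summable_iff.mpr hsummable)
  rw [Finset.prod_add, ← Finset.sum_coe_sort K.powerset]
  exact hasSum_fintype _

/-- The generating function of the densities of the patterns. -/
theorem hasSum_patternDensity (hL : ∀ i, 2 < L i) (hsum : Summable fun i => 1 / L i) (z w : ℂ) :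
    HasSum (fun p : {p : Finset ι × Finset ι // Disjoint p.1 p.2} =>
      (patternDensity L p.1.1 p.1.2 : ℂ) * z ^ p.1.1.card * w ^ p.1.2.card)
      (∏' i, (1 + (z + w - 2) / (L i : ℂ))) := by
  classical
  have hu : Summable fun i => ‖((1 / (L i - 2) : ℝ) : ℂ)‖ := by
    simp only [Complex.norm_real]
    exact (summable_one_div_sub_two hL hsum).norm
  have hz : ∀ z : ℂ, Summable fun i => ‖z * ((1 / (L i - 2) : ℝ) : ℂ)‖ := fun z => by
    simp only [norm_mul]
    exact hu.mul_left _
  have hD : HasProd (fun i => ((1 - 2 / L i : ℝ) : ℂ)) ((∏' i, (1 - 2 / L i) : ℝ) : ℂ) :=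
    (multipliable_one_sub_two_div hsum).hasProd.map Complex.ofRealHom Complex.continuous_ofReal
  have hmul : Multipliable fun i =>
      1 + (z * ((1 / (L i - 2) : ℝ) : ℂ) + w * ((1 / (L i - 2) : ℝ) : ℂ)) :=
    multipliable_one_add_of_summable
      (((hz z).add (hz w)).of_nonneg_of_le (fun _ => norm_nonneg _) fun _ => norm_add_le _ _)
  have hprod : ∏' i, (1 + (z + w - 2) / (L i : ℂ)) = ((∏' i, (1 - 2 / L i) : ℝ) : ℂ) *
      ∏' i, (1 + (z * ((1 / (L i - 2) : ℝ) : ℂ) + w * ((1 / (L i - 2) : ℝ) : ℂ))) := by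
    rw [← (hD.mul hmul.hasProd).tprod_eq]
    refine tprod_congr fun i => ?_
    have h2 := hL i
    have h3 : (L i : ℂ) ≠ 0 := by
      exact_mod_cast (show L i ≠ 0 by linarith)
    have h4 : (L i : ℂ) - 2 ≠ 0 := by
      exact_mod_cast (show L i - 2 ≠ 0 by linarith)
    push_cast
    field_simp
    ring
  rw [hprod]
  have h := (hasSum_disjointPairs (hz z) (hz w)).mul_left ((∏' i, (1 - 2 / L i) : ℝ) : ℂ)
  refine h.congr_fun fun p => ?_
  rw [Finset.prod_mul_distrib, Finset.prod_mul_distrib, Finset.prod_const, Finset.prod_const,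
    patternDensity, Finset.prod_union p.2]
  push_cast
  ring

/-- At `z = w = 1` every factor of the generating product is 1. This total mass turns the lower
bounds into densities. -/
theorem hasSum_patternDensity_one (hL : ∀ i, 2 < L i) (hsum : Summable fun i => 1 / L i) :
    HasSum (fun p : {p : Finset ι × Finset ι // Disjoint p.1 p.2} =>
      patternDensity L p.1.1 p.1.2) 1 := by
  have h := hasSum_patternDensity hL hsum 1 1
  simp only [one_pow, mul_one] at h
  norm_num at h
  exact Complex.hasSum_ofReal.mp (by simpa using h)

theorem pairwise_disjoint_hitPattern (L : ι → ℝ) :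
    Pairwise (Function.onFun Disjoint
      fun p : {p : Finset ι × Finset ι // Disjoint p.1 p.2} => HitPattern L p.1.1 p.1.2) := by
  intro p q hpq
  refine Set.disjoint_left.mpr fun n hp hq => hpq (Subtype.ext (Prod.ext ?_ ?_))
  · ext i
    rw [← (hp.2 i).1, (hq.2 i).1]
  · ext i
    rw [← (hp.2 i).2, (hq.2 i).2]

/-- Every union of sets `HitPattern L I J` has the expected density. -/
theorem hasDensity_biUnion_hitPattern (hL : ∀ i, 2 < L i) (hsum : Summable fun i => 1 / L i)
    (hli : LinearIndependent ℚ (fun o : Option ι => o.elim (1 : ℝ) fun i => 1 / L i))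
    (Q : Set {p : Finset ι × Finset ι // Disjoint p.1 p.2}) :
    HasDensity (⋃ p ∈ Q, HitPattern L p.1.1 p.1.2) (∑' p : Q, patternDensity L p.1.1.1 p.1.1.2) :=
  hasDensity_biUnion (pairwise_disjoint_hitPattern L) (fun _ _ hn => hn.1)
    (fun p => lowerDensityGE_hitPattern hL hsum hli p.2 (hasProd_patternDensity hL hsum _ _))
    (hasSum_patternDensity_one hL hsum) Q

end GeneratingFunction

/-! ### The sets of the theorem as hit patterns -/

theorem Lam_exists_natCast_eq {k : ℕ} (hk : k ≠ 0) {x : ℝ} (hx : x ∈ Lam k) (a : ℕ) :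
    ∃ n : ℕ, (n : ℝ) = (a : ℝ) ^ k * x ^ k := by
  obtain ⟨N, -, -, rfl⟩ := (mem_Lam_iff x).mp hx
  exact ⟨a ^ k * N, by rw [rpow_inv_pow hk]; push_cast; rfl⟩

theorem mem_Ioo_pow_inter_S_iff {k : ℕ} (hk : k ≠ 0) {I : Set ℝ} (hI : I ⊆ Lam k) {s t n : ℕ} :
    n ∈ Set.Ioo (s ^ k) (t ^ k) ∩ S k I ↔ ∃ x ∈ I, ∃ a : ℕ, (s : ℝ) < a * x ∧ a * x < t ∧
      (n : ℝ) = (a : ℝ) ^ k * x ^ k := by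
  constructor
  · rintro ⟨⟨h1, h2⟩, a, -, x, hx, h⟩
    have hx0 : 0 ≤ x := by
      obtain ⟨N, -, -, rfl⟩ := (mem_Lam_iff x).mp (hI hx)
      positivity
    have h3 : (s : ℝ) ^ k < n := by exact_mod_cast h1
    have h4 : (n : ℝ) < (t : ℝ) ^ k := by exact_mod_cast h2
    rw [h, ← mul_pow] at h3 h4
    exact ⟨x, hx, a, lt_of_pow_lt_pow_left₀ k (by positivity) h3,
      lt_of_pow_lt_pow_left₀ k (by positivity) h4, h⟩
  · rintro ⟨x, hx, a, h1, h2, h⟩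
    have hs : (0 : ℝ) ≤ s := Nat.cast_nonneg s
    have h3 := pow_lt_pow_left₀ h1 hs hk
    have h4 := pow_lt_pow_left₀ h2 (hs.trans h1.le) hk
    rw [mul_pow, ← h] at h3 h4
    refine ⟨⟨by exact_mod_cast h3, by exact_mod_cast h4⟩, a, ?_, x, hx, h⟩
    rcases Nat.eq_zero_or_pos a with rfl | ha
    · rw [Nat.cast_zero, zero_mul] at h1
      exact absurd h1 (not_lt.mpr hs)
    · exact ha

/-- The number of elements of `S_I` in `(s ^ k, t ^ k)`, where `t ≤ s + 2`, is the number of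
`x ∈ I` with a multiple in `(s, t)`. -/
theorem ncard_Ioo_pow_inter_S {k : ℕ} (hk : 2 ≤ k) {I : Set ℝ} (hI : I ⊆ Lam k) {s t : ℕ}
    (hst : t ≤ s + 2) :
    (Set.Ioo (s ^ k) (t ^ k) ∩ S k I).ncard = {x ∈ I | Hit x s t}.ncard := by
  have hk0 : k ≠ 0 := by omega
  have hex : ∀ x ∈ {x ∈ I | Hit x s t}, ∃ n a : ℕ, (s : ℝ) < a * x ∧ a * x < t ∧
      (n : ℝ) = (a : ℝ) ^ k * x ^ k := by
    rintro x ⟨hx, a, h1, h2⟩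
    obtain ⟨n, hn⟩ := Lam_exists_natCast_eq hk0 (hI hx) a
    exact ⟨n, a, h1, h2, hn⟩
  choose f a ha1 ha2 hf using hex
  have hne : ∀ {x : ℝ} {a : ℕ}, (s : ℝ) < a * x → a ≠ 0 := by
    rintro x a h rfl
    rw [Nat.cast_zero, zero_mul] at h
    exact absurd h (not_lt.mpr (Nat.cast_nonneg s))
  symm
  -- Injectivity is uniqueness of the representation; surjectivity holds because an interval of
  -- length at most `2 < x` contains only one multiple of `x`.
  refine Set.ncard_congr f (fun x hx => ?_) (fun x y hx hy hxy => ?_) fun n hn => ?_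
  · exact (mem_Ioo_pow_inter_S_iff hk0 hI).mpr
      ⟨x, hx.1, a x hx, ha1 x hx, ha2 x hx, hf x hx⟩
  · have h := hf x hx
    rw [hxy, hf y hy, ← mul_pow, ← mul_pow] at h
    have hx0 : (0 : ℝ) ≤ a x hx * x := (Nat.cast_nonneg s).trans (ha1 x hx).le
    have hy0 : (0 : ℝ) ≤ a y hy * y := (Nat.cast_nonneg s).trans (ha1 y hy).le
    exact Lam_eq_of_mul_eq hk0 (hI hx.1) (hI hy.1) (hne (ha1 x hx)) (hne (ha1 y hy))
      ((pow_left_inj₀ hx0 hy0 hk0).mp h.symm)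
  · obtain ⟨x, hx, b, h1, h2, h⟩ := (mem_Ioo_pow_inter_S_iff hk0 hI).mp hn
    have hx' : x ∈ {x ∈ I | Hit x s t} := ⟨hx, b, h1, h2⟩
    refine ⟨x, hx', ?_⟩
    have hx2 := two_lt_of_mem_Lam hk (hI hx)
    have hst' : (t : ℝ) ≤ s + 2 := by exact_mod_cast hst
    have hab : a x hx' = b :=
      eq_of_mul_mem_Ioo (l := x) (by linarith) (ha1 x hx') (ha2 x hx') h1 h2
    have := hf x hx'
    rw [hab, ← h] at this
    exact_mod_cast this

theorem Hit.or_of_Lam {k : ℕ} (hk : k ≠ 0) {x : ℝ} (hx : x ∈ Lam k) {n : ℕ}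
    (h : Hit x n (n + 2)) : Hit x n (n + 1) ∨ Hit x (n + 1) (n + 2) := by
  obtain ⟨a, h1, h2⟩ := h
  have ha : a ≠ 0 := by
    rintro rfl
    rw [Nat.cast_zero, zero_mul] at h1
    exact absurd h1 (not_lt.mpr (Nat.cast_nonneg n))
  rcases lt_trichotomy ((a : ℝ) * x) (n + 1) with h | h | h
  · exact .inl ⟨a, h1, h⟩
  · exact absurd (h.trans (by push_cast; rfl)) (Lam_mul_ne_natCast hk hx ha (n + 1))
  · exact .inr ⟨a, h, h2⟩

/-- Reading a finite subset of the type `Λ_k` as a finite set of real numbers. -/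
noncomputable def toReal {k : ℕ} (I : Finset (Lam k)) : Finset ℝ :=
  I.map (Function.Embedding.subtype _)

theorem coe_mem_toReal {k : ℕ} {I : Finset (Lam k)} {x : Lam k} : (x : ℝ) ∈ toReal I ↔ x ∈ I := by
  simp [toReal]

theorem toReal_subset {k : ℕ} (I : Finset (Lam k)) : (toReal I : Set ℝ) ⊆ Lam k := by
  intro x hx
  obtain ⟨y, -, rfl⟩ := Finset.mem_map.mp (Finset.mem_coe.mp hx)
  exact y.2

theorem exists_toReal_eq {k : ℕ} {I : Finset ℝ} (hI : (I : Set ℝ) ⊆ Lam k) :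
    ∃ I' : Finset (Lam k), toReal I' = I := by
  classical
  exact ⟨I.subtype (· ∈ Lam k), Finset.subtype_map_of_mem hI⟩

theorem disjoint_toReal {k : ℕ} {I J : Finset (Lam k)} :
    Disjoint (toReal I) (toReal J) ↔ Disjoint I J := Finset.disjoint_map _

theorem card_toReal {k : ℕ} (I : Finset (Lam k)) : (toReal I).card = I.card := Finset.card_map _

theorem ncard_hit_toReal_eq_card_iff {k : ℕ} (I : Finset (Lam k)) (s t : ℝ) :
    {x ∈ (toReal I : Set ℝ) | Hit x s t}.ncard = (toReal I).card ↔
      ∀ x : Lam k, x ∈ I → Hit (x : ℝ) s t := by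
  rw [← Set.ncard_coe_finset]
  constructor
  · intro h x hx
    have := Set.eq_of_subset_of_ncard_le (Set.sep_subset _ _) h.ge (Finset.finite_toSet _)
    have h1 : (x : ℝ) ∈ (toReal I : Set ℝ) := Finset.mem_coe.mpr (coe_mem_toReal.mpr hx)
    rw [← this] at h1
    exact h1.2
  · intro h
    congr 1
    refine Set.Subset.antisymm (Set.sep_subset _ _) fun x hx => ⟨hx, ?_⟩
    exact h ⟨x, toReal_subset I hx⟩ (coe_mem_toReal.mp hx)

/-- The emptiness condition handles indices outside `I ∪ J`; an index inside cannot hit both unit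
intervals, so its prescribed hit excludes the other. -/
theorem B_eq_hitPattern {k : ℕ} (hk : 2 ≤ k) (I J : Finset (Lam k)) :
    B k (toReal I) (toReal J) = HitPattern (fun x : Lam k => (x : ℝ)) I J := by
  have hk0 : k ≠ 0 := by omega
  have hL : ∀ x : Lam k, 2 ≤ (x : ℝ) := fun x => (two_lt_of_mem_Lam hk x.2).le
  ext n
  have h3 : (Set.Ioo (n ^ k) ((n + 2) ^ k) ∩ S k (Lam k \ ((toReal I : Set ℝ) ∪ toReal J)) = ∅) ↔
      ∀ x : Lam k, x ∉ I → x ∉ J → ¬ Hit (x : ℝ) n (n + 2) := by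
    rw [Set.eq_empty_iff_forall_notMem]
    simp only [mem_Ioo_pow_inter_S_iff hk0 Set.sdiff_subset]
    constructor
    · rintro h x hxI hxJ ⟨a, h1, h2⟩
      obtain ⟨m, hm⟩ := Lam_exists_natCast_eq hk0 x.2 a
      refine h m ⟨x, ⟨x.2, ?_⟩, a, h1, by push_cast; exact h2, hm⟩
      rintro (hx | hx)
      · exact hxI (coe_mem_toReal.mp hx)
      · exact hxJ (coe_mem_toReal.mp hx)
    · rintro h m ⟨x, ⟨hx, hx'⟩, a, h1, h2, -⟩
      refine h ⟨x, hx⟩ (fun hI => hx' (.inl (coe_mem_toReal.mpr hI)))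
        (fun hJ => hx' (.inr (coe_mem_toReal.mpr hJ))) ⟨a, h1, by push_cast at h2; exact h2⟩
  have h1 := ncard_Ioo_pow_inter_S hk (toReal_subset I) (s := n) (t := n + 1) (by omega)
  have h2 := ncard_Ioo_pow_inter_S hk (toReal_subset J) (s := n + 1) (t := n + 2) (by omega)
  change (1 ≤ n ∧ _ ∧ _ ∧ _) ↔ (1 ≤ n ∧ _)
  rw [h1, h2, h3, ncard_hit_toReal_eq_card_iff, ncard_hit_toReal_eq_card_iff]
  push_cast
  refine and_congr_right fun _ => ⟨?_, fun h => ⟨fun x hx => (h x).1.mpr hx,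
    fun x hx => (h x).2.mpr hx, fun x hxI hxJ hx => ?_⟩⟩
  · rintro ⟨hI, hJ, hno⟩ x
    constructor
    · refine ⟨fun h => ?_, hI x⟩
      by_contra hxI
      by_cases hxJ : x ∈ J
      · exact not_hit_and_hit (hL x) h (hJ x hxJ)
      · exact hno x hxI hxJ (h.mono le_rfl (by linarith))
    · refine ⟨fun h => ?_, hJ x⟩
      by_contra hxJ
      by_cases hxI : x ∈ I
      · exact not_hit_and_hit (hL x) (hI x hxI) h
      · exact hno x hxI hxJ (h.mono (by linarith) le_rfl)
  · rcases hx.or_of_Lam hk0 x.2 with h' | h'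
    · exact hxI ((h x).1.mp h')
    · exact hxJ ((h x).2.mp h')

/-- The pairs of disjoint finite subsets of `Λ_k`. -/
abbrev LamPair (k : ℕ) : Type :=
  {p : Finset (Lam k) × Finset (Lam k) // Disjoint p.1 p.2}

/-- The cardinalities of a pair of finite sets. -/
def LamPair.cards {k : ℕ} (p : LamPair k) : ℕ × ℕ := (p.1.1.card, p.1.2.card)

/-- A hit forces `x < t`, and summability of `1 / x` leaves finitely many such `x`. -/
theorem finite_setOf_hit {k : ℕ} (hk : 2 ≤ k) (s t : ℕ) :
    {x : Lam k | Hit (x : ℝ) s t}.Finite := by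
  have h := (summable_inv_Lam (k := k) (by omega)).tendsto_cofinite_zero.eventually
    (gt_mem_nhds (show (0 : ℝ) < 1 / (t + 1) by positivity))
  refine (Filter.eventually_cofinite.mp h).subset ?_
  rintro x ⟨a, h1, h2⟩
  have hx := two_lt_of_mem_Lam hk x.2
  have ha : (1 : ℝ) ≤ a := by
    rcases Nat.eq_zero_or_pos a with rfl | ha
    · rw [Nat.cast_zero, zero_mul] at h1
      exact absurd h1 (not_lt.mpr (Nat.cast_nonneg s))
    · exact_mod_cast ha
  have : (x : ℝ) ≤ t + 1 := by nlinarith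
  exact not_lt.mpr (one_div_le_one_div_of_le (by linarith) this)

theorem ncard_Ioo_pow_inter_nonPowerKFull {k : ℕ} (hk : 2 ≤ k) {s t : ℕ} (hst : t ≤ s + 2) :
    (Set.Ioo (s ^ k) (t ^ k) ∩ NonPowerKFull k).ncard =
      (finite_setOf_hit hk s t).toFinset.card := by
  rw [nonPowerKFull_eq (by omega), ncard_Ioo_pow_inter_S hk subset_rfl hst, ← card_toReal,
    ← Set.ncard_coe_finset]
  congr 1
  ext x
  constructor
  · rintro ⟨hx, h⟩
    exact Finset.mem_coe.mpr ((coe_mem_toReal (x := ⟨x, hx⟩)).mpr (by simpa using h))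
  · intro hx
    have h1 := toReal_subset _ hx
    have h2 := (coe_mem_toReal (x := ⟨x, h1⟩)).mp hx
    exact ⟨h1, by simpa using h2⟩

/-- Every `n ≥ 1` has exactly one pattern, given by the sets of indices hitting the two intervals;
`A` fixes only their cardinalities. -/
theorem A_eq_iUnion_hitPattern {k : ℕ} (hk : 2 ≤ k) (l m : ℕ) :
    A k l m = ⋃ p ∈ (LamPair.cards ⁻¹' {(l, m)} : Set (LamPair k)),
      HitPattern (fun x : Lam k => (x : ℝ)) p.1.1 p.1.2 := by
  ext n
  have h1 := ncard_Ioo_pow_inter_nonPowerKFull hk (s := n) (t := n + 1) (by omega)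
  have h2 := ncard_Ioo_pow_inter_nonPowerKFull hk (s := n + 1) (t := n + 2) (by omega)
  set I := (finite_setOf_hit hk n (n + 1)).toFinset with hI
  set J := (finite_setOf_hit hk (n + 1) (n + 2)).toFinset with hJ
  have hmemI : ∀ x : Lam k, Hit (x : ℝ) n (n + 1) ↔ x ∈ I := fun x => by simp [hI]
  have hmemJ : ∀ x : Lam k, Hit (x : ℝ) (n + 1) (n + 2) ↔ x ∈ J := fun x => by simp [hJ]
  change (1 ≤ n ∧ _ ∧ _) ↔ _
  rw [h1, h2]
  simp only [Set.mem_iUnion, Set.mem_preimage, Set.mem_singleton_iff, LamPair.cards, Prod.mk.injEq]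
  constructor
  · rintro ⟨hn, hl, hm⟩
    refine ⟨⟨(I, J), ?_⟩, ⟨hl, hm⟩, hn, fun x => ⟨hmemI x, hmemJ x⟩⟩
    exact Finset.disjoint_left.mpr fun x hx hx' => not_hit_and_hit
      (two_lt_of_mem_Lam hk x.2).le ((hmemI x).mpr hx) ((hmemJ x).mpr hx')
  · rintro ⟨⟨⟨I', J'⟩, hd⟩, ⟨hl, hm⟩, hn, h⟩
    have hI' : I = I' := Finset.ext fun x => (hmemI x).symm.trans (h x).1
    have hJ' : J = J' := Finset.ext fun x => (hmemJ x).symm.trans (h x).2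
    exact ⟨hn, hI' ▸ hl, hJ' ▸ hm⟩

/-- The pairs with given cardinalities, as pairs of finite sets of real numbers. -/
noncomputable def pairEquiv (k l m : ℕ) :
    (LamPair.cards ⁻¹' {(l, m)} : Set (LamPair k)) ≃ DisjointPairs k l m :=
  Equiv.ofBijective (fun p => ⟨(toReal p.1.1.1, toReal p.1.1.2), toReal_subset _, toReal_subset _,
      (card_toReal _).trans (congrArg Prod.fst p.2), (card_toReal _).trans (congrArg Prod.snd p.2),
      disjoint_toReal.mpr p.1.2⟩) <| by
    constructor
    · intro p q h
      have h1 := congrArg (fun t => t.1.1) h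
      have h2 := congrArg (fun t => t.1.2) h
      exact Subtype.ext (Subtype.ext (Prod.ext (Finset.map_injective _ h1)
        (Finset.map_injective _ h2)))
    · rintro ⟨⟨I, J⟩, hI, hJ, hl, hm, hd⟩
      obtain ⟨I, rfl⟩ := exists_toReal_eq hI
      obtain ⟨J, rfl⟩ := exists_toReal_eq hJ
      exact ⟨⟨⟨(I, J), disjoint_toReal.mp hd⟩, Prod.ext ((card_toReal _).symm.trans hl)
        ((card_toReal _).symm.trans hm)⟩, rfl⟩

theorem nonempty_lamPair {k : ℕ} (hk : 2 ≤ k) (l m : ℕ) :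
    (LamPair.cards ⁻¹' {(l, m)} : Set (LamPair k)).Nonempty := by
  classical
  have : Infinite (Lam k) := (Lam_infinite hk).to_subtype
  obtain ⟨K, hK⟩ := Infinite.exists_subset_card_eq (Lam k) (l + m)
  obtain ⟨I, hIK, hI⟩ := Finset.exists_subset_card_eq (show l ≤ K.card by omega)
  refine ⟨⟨(I, K \ I), Finset.disjoint_sdiff⟩, Prod.ext hI ?_⟩
  change (K \ I).card = m
  rw [Finset.card_sdiff_of_subset hIK]
  omega

open Classical in
/-- The factorization of the density of `B_{I,J}`. -/
theorem patternDensity_eq_prod_mul_tprod {Λ : Set ℝ} (hL : ∀ x : Λ, 2 < (x : ℝ))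
    (hsum : Summable fun x : Λ => 1 / (x : ℝ)) (I J : Finset Λ) {K : Finset ℝ}
    (hK : ∀ x, x ∈ K ↔ ∃ h : x ∈ Λ, (⟨x, h⟩ : Λ) ∈ I ∪ J) {T : Set ℝ} (hT : T = Λ \ K) :
    Multipliable (fun x : T => 1 - 2 / (x : ℝ)) ∧
    patternDensity (fun x : Λ => (x : ℝ)) I J = (∏ x ∈ K, 1 / x) *
      ∏' x : T, (1 - 2 / (x : ℝ)) := by
  have hTΛ : T ⊆ Λ := hT ▸ Set.sdiff_subset
  have hmul : Multipliable (fun x : T => 1 - 2 / (x : ℝ)) :=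
    multipliable_one_sub_two_div (L := fun x : T => (x : ℝ))
      (hsum.comp_injective (i := Set.inclusion hTΛ) (Set.inclusion_injective hTΛ))
  refine ⟨hmul, ?_⟩
  have h1 := hasProd_patternDensity hL hsum I J
  have h3 : HasProd (fun x : ℝ => if x ∈ K then 1 / x else 1) (∏ x ∈ K, 1 / x) := by
    rw [← Finset.prod_congr rfl fun x (hx : x ∈ K) => if_pos hx]
    exact hasProd_prod_of_ne_finset_one fun x hx => if_neg hx
  -- Products over different subtypes are compared by extending all of them by 1 to `ℝ`.
  have h4 : HasProd (Λ.mulIndicator fun x : ℝ => if x ∈ K then 1 / x else 1 - 2 / x)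
      (patternDensity (fun x : Λ => (x : ℝ)) I J) := by
    rw [← hasProd_subtype_iff_mulIndicator]
    refine h1.congr_fun fun x => ?_
    have : (x : ℝ) ∈ K ↔ x ∈ I ∪ J := (hK x).trans ⟨fun h => h.2, fun h => ⟨x.2, h⟩⟩
    simp only [Function.comp_apply, this]
    congr!
  have h5 := hasProd_subtype_iff_mulIndicator (f := fun x : ℝ => 1 - 2 / x).mp hmul.hasProd
  refine h4.unique ((h3.mul h5).congr_fun fun x => ?_)
  by_cases hx : x ∈ K
  · have hxT : x ∉ T := fun h => (hT ▸ h).2 hx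
    rw [Set.mulIndicator_of_mem ((hK x).mp hx).1, if_pos hx, if_pos hx,
      Set.mulIndicator_of_notMem hxT, mul_one]
  · rw [if_neg hx, one_mul]
    by_cases hxL : x ∈ Λ
    · rw [Set.mulIndicator_of_mem hxL, if_neg hx, Set.mulIndicator_of_mem (hT ▸ ⟨hxL, hx⟩)]
    · rw [Set.mulIndicator_of_notMem hxL, Set.mulIndicator_of_notMem fun h => hxL (hTΛ h)]

theorem HasDensity.density_eq {X : Set ℕ} {d : ℝ} (h : HasDensity X d) : density X = d :=
  h.limUnder_eq

theorem hasDensity_B {k : ℕ} (hk : 2 ≤ k) (p : LamPair k) :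
    HasDensity (B k (toReal p.1.1) (toReal p.1.2))
      (patternDensity (fun x : Lam k => (x : ℝ)) p.1.1 p.1.2) := by
  have h := hasDensity_biUnion_hitPattern (fun x : Lam k => two_lt_of_mem_Lam hk x.2)
    (summable_inv_Lam (by omega)) (linearIndependent_inv_Lam (by omega)) {p}
  rw [Set.biUnion_singleton, tsum_singleton p fun p : LamPair k =>
    patternDensity (fun x : Lam k => (x : ℝ)) p.1.1 p.1.2] at h
  rwa [B_eq_hitPattern hk]

theorem hasDensity_A {k : ℕ} (hk : 2 ≤ k) (l m : ℕ) :
    HasDensity (A k l m) (∑' p : (LamPair.cards ⁻¹' {(l, m)} : Set (LamPair k)),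
      patternDensity (fun x : Lam k => (x : ℝ)) p.1.1.1 p.1.1.2) := by
  rw [A_eq_iUnion_hitPattern hk]
  exact hasDensity_biUnion_hitPattern (fun x : Lam k => two_lt_of_mem_Lam hk x.2)
    (summable_inv_Lam (by omega)) (linearIndependent_inv_Lam (by omega)) _

end KFull

theorem mainTheorem3 (k : ℕ) (hk : 2 ≤ k) :
    -- each set `B_{I,J}` has a positive density, given by a convergent product
    (∀ I J : Finset ℝ, (I : Set ℝ) ⊆ KFull.Lam k → (J : Set ℝ) ⊆ KFull.Lam k → Disjoint I J →
      KFull.HasDensity (KFull.B k I J) (KFull.density (KFull.B k I J)) ∧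
      0 < KFull.density (KFull.B k I J) ∧
      Multipliable (fun x : ↥(KFull.Lam k \ ((I : Set ℝ) ∪ (J : Set ℝ))) => 1 - 2 / (x : ℝ)) ∧
      KFull.density (KFull.B k I J) =
        (∏ x ∈ I ∪ J, 1 / x) *
          ∏' x : ↥(KFull.Lam k \ ((I : Set ℝ) ∪ (J : Set ℝ))), (1 - 2 / (x : ℝ))) ∧
    -- each set `A_{l,m}` has a positive density, the sum of the densities of the `B_{I,J}`
    (∀ l m : ℕ,
      KFull.HasDensity (KFull.A k l m) (KFull.density (KFull.A k l m)) ∧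
      0 < KFull.density (KFull.A k l m) ∧
      HasSum (fun p : ↥(KFull.DisjointPairs k l m) => KFull.density (KFull.B k p.1.1 p.1.2))
        (KFull.density (KFull.A k l m))) ∧
    -- the generating function
    (∀ z w : ℂ,
      Multipliable (fun x : ↥(KFull.Lam k) => 1 + (z + w - 2) / ((x : ℝ) : ℂ)) ∧
      HasSum (fun q : ℕ × ℕ => (KFull.density (KFull.A k q.1 q.2) : ℂ) * z ^ q.1 * w ^ q.2)
        (∏' x : ↥(KFull.Lam k), (1 + (z + w - 2) / ((x : ℝ) : ℂ)))) := by
  have hL : ∀ x : KFull.Lam k, 2 < (x : ℝ) := fun x => KFull.two_lt_of_mem_Lam hk x.2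
  have hsum := KFull.summable_inv_Lam (k := k) (by omega)
  have hone := KFull.hasSum_patternDensity_one hL hsum
  refine ⟨fun I J hI hJ hIJ => ?_, fun l m => ?_, fun z w => ⟨?_, ?_⟩⟩
  · obtain ⟨I, rfl⟩ := KFull.exists_toReal_eq hI
    obtain ⟨J, rfl⟩ := KFull.exists_toReal_eq hJ
    have h := KFull.hasDensity_B hk ⟨(I, J), KFull.disjoint_toReal.mp hIJ⟩
    obtain ⟨h1, h2⟩ := KFull.patternDensity_eq_prod_mul_tprod hL hsum I J
      (K := KFull.toReal I ∪ KFull.toReal J)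
      (T := KFull.Lam k \ ((KFull.toReal I : Set ℝ) ∪ KFull.toReal J))
      (fun x => by simp [KFull.toReal, exists_or]) (by rw [Finset.coe_union])
    rw [h.density_eq]
    exact ⟨h, KFull.patternDensity_pos hL hsum I J, h1, h2⟩
  · have h := KFull.hasDensity_A hk l m
    have hs := hone.summable.subtype (KFull.LamPair.cards ⁻¹' {(l, m)})
    rw [h.density_eq]
    refine ⟨h, ?_, ?_⟩
    · obtain ⟨p, hp⟩ := KFull.nonempty_lamPair hk l m
      exact hs.tsum_pos (fun q => (KFull.patternDensity_pos hL hsum _ _).le) ⟨p, hp⟩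
        (KFull.patternDensity_pos hL hsum _ _)
    · rw [← (KFull.pairEquiv k l m).hasSum_iff]
      exact hs.hasSum.congr_fun fun p => (KFull.hasDensity_B hk p.1).density_eq
  · refine multipliable_one_add_of_summable ?_
    simp only [div_eq_mul_inv, norm_mul]
    refine Summable.mul_left _ ?_
    simpa using hsum.norm
  -- The sum over all pairs is regrouped by cardinalities; on each fibre the monomial `z ^ l * w ^
  -- m` is constant and the densities add up to that of `A`.
  · have h := (KFull.hasSum_patternDensity hL hsum z w).tsum_fiberwise KFull.LamPair.cards
    refine h.congr_fun fun q => ?_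
    obtain ⟨l, m⟩ := q
    rw [(KFull.hasDensity_A hk l m).density_eq, Complex.ofReal_tsum, ← tsum_mul_right,
      ← tsum_mul_right]
    refine tsum_congr fun p => ?_
    have h1 : p.1.1.1.card = l := congrArg Prod.fst p.2
    have h2 : p.1.1.2.card = m := congrArg Prod.snd p.2
    rw [h1, h2]
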